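/- Let $q$ be a power of a prime $p$, let $\mathcal L=\overline{\mathbb F}_q$, let $k$ be a divisor of $q^2+q+1$ with $k>\frac23(q+2)$, and put $t=q-k+2$. Let $\omega$ be a primitive element of $\mathbb F_{q^3}$, $a=\omega^{q-1}$, $b=a^{(q^2+q+1)/k}$, and consider the collineations $\beta:(x_1,x_2,x_3)\mapsto(bx_1,b^{q+1}x_2,x_3)$ and $\mu:(x_1,x_2,x_3)\mapsto(x_3,x_1,x_2)$ of the projective plane. Let $\mathcal C$ be a cyclic curve, i.e. a plane projective curve of degree $2t$ defined over $\mathbb F_q$, preserved by $\beta$ and $\mu$, and having none of the lines $x_1=0$, $x_2=0$, $x_3=0$ as a component; assume that $\mathcal C$ is irreducible over $\mathcal L$. Let $\Sigma=\mathcal L(\mathcal C)=\mathcal L(x,y)$ be its function field, where $x=x_1/x_3$ and $y=x_2/x_3$, let $\Phi(x,y)=(x',y')=\left(\frac{y}{x^{t-1}},\frac{y^{t-1}}{x^{t-2}}\right)$, and let $\Sigma'=\mathcal L(x',y')\subseteq\Sigma$. The curve $\mathcal C$ is said to be of the first type if at each of the vertices $A_1=(1,0,0)$, $A_2=(0,1,0)$,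 $A_3=(0,0,1)$ there are centered two linear branches of $\mathcal C$, each of which meets the tangent (the line $x_3=0$, $x_1=0$, $x_2=0$, respectively) with multiplicity $t-1$; otherwise it is of the second type. The different of $\Sigma:\Sigma'$ is the divisor $D=\sum_\gamma D_\gamma$ over all branches $\gamma$ of $\mathcal C$ with $D_\gamma=\operatorname{ord}_\tau\frac{dz}{d\tau}$, where $\tau$ is a local parameter at $\gamma$ and $z\in\Sigma'$ is a local parameter at the image branch $\gamma'=\Phi(\gamma)$. Suppose that $k^2-k+1\not\equiv0\pmod p$, and that $k\ge q-\sqrt{\frac32q+\frac1{16}}+\frac94$ or, more generally, that $\Phi$ maps $\mathcal C$ onto a conic or a line. Then $\Phi$ maps $\mathcal C$ onto a conic or a line, $[\Sigma:\Sigma']=t^2-3t+3$, and the different of $\Sigma:\Sigma'$ has order $6(t^2-3t+2)$ if $\mathcal C$ is of the first type and $3(t^2-3t+2)$ if $\mathcal C$ is of the second type. -/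

import Mathlib

open MvPolynomial

noncomputable section

/-! ## Places of a field extension `K / L` -/

/-- `π` generates the maximal ideal of the valuation ring `V` (and is nonzero). -/
def IsUniformizer {K : Type*} [Field K] (V : ValuationSubring K) (π : K) : Prop :=
  π ≠ 0 ∧ V.valuation π < 1 ∧ ∀ f : K, V.valuation f < 1 → V.valuation f ≤ V.valuation π

/-- `f` has order `n ∈ ℤ` at `V`, i.e. `f` is a unit of `V` times the `n`-th power of a
uniformizer. In particular `f ≠ 0`, and `n` is uniquely determined by `f`. -/
def HasOrder {K : Type*} [Field K] (V : ValuationSubring K) (f : K) (n : ℤ) : Prop :=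
  ∃ π : K, IsUniformizer V π ∧ V.valuation f = V.valuation π ^ n

/-- A place of `K / L`: a nontrivial valuation ring of `K` containing `L`. If `K` is the
function field of an irreducible curve over an algebraically closed field `L`, the places of
`K / L` are the branches of the curve. -/
structure Place (L K : Type*) [Field L] [Field K] [Algebra L K] where
  ring : ValuationSubring K
  algebraMap_mem : ∀ c : L, algebraMap L K c ∈ ring
  ne_top : ring ≠ ⊤

/-- The exponent at the place `P` of the different of `K / K'`: it is `ord_P (dz / dτ)`, where
`τ` is a local parameter at `P`, `z` is a local parameter at the place `P ∩ K'` of `K'` below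
`P`, and `dz / dτ` is the function `w` with `dz = w dτ` in the differentials of `K / L`.
(The value does not depend on the choice of `τ` and `z`.) -/
def IsDifferentExponent {L K : Type*} [Field L] [Field K] [Algebra L K]
    (K' : IntermediateField L K) (P : Place L K) (e : ℤ) : Prop :=
  ∃ (τ : K) (z : K') (w : K), IsUniformizer P.ring τ ∧
    IsUniformizer (P.ring.comap (algebraMap K' K)) z ∧
    KaehlerDifferential.D L K (z : K) = w • KaehlerDifferential.D L K τ ∧
    HasOrder P.ring w e

/-- The divisor `D` of `K` is the different of `K / K'`. -/
def IsDifferent {L K : Type*} [Field L] [Field K] [Algebra L K]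
    (K' : IntermediateField L K) (D : Place L K →₀ ℤ) : Prop :=
  ∀ P : Place L K, IsDifferentExponent K' P (D P)

/-- The order (degree) of a divisor; all places have residue field `L` when `L` is algebraically
closed and `K / L` is a function field of one variable. -/
def divisorOrder {L K : Type*} [Field L] [Field K] [Algebra L K] (D : Place L K →₀ ℤ) : ℤ :=
  D.sum fun _ e => e

/-! ## Irreducible projective plane curves and their function fields -/

/-- An irreducible curve of degree `n` in the projective plane over `L`, given by a homogeneous
equation. The coordinates `x₁, x₂, x₃` are indexed by `0, 1, 2`. -/
structure IrredPlaneCurve (L : Type*) [Field L] (n : ℕ) where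
  eqn : MvPolynomial (Fin 3) L
  homogeneous : eqn.IsHomogeneous n
  irreducible : Irreducible eqn

namespace IrredPlaneCurve

variable {L : Type*} [Field L] {n : ℕ} (C : IrredPlaneCurve L n)

/-- The homogeneous coordinate ring `L[x₁, x₂, x₃] / (F)`. -/
abbrev CoordRing : Type _ := MvPolynomial (Fin 3) L ⧸ Ideal.span {C.eqn}

instance : IsDomain C.CoordRing := by
  have h : (Ideal.span {C.eqn}).IsPrime :=
    (Ideal.span_singleton_prime C.irreducible.ne_zero).2 C.irreducible.prime
  exact Ideal.Quotient.isDomain _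

/-- The homogeneous coordinate function `xᵢ`, in the fraction field of the homogeneous
coordinate ring. -/
def coord (i : Fin 3) : FractionRing C.CoordRing :=
  algebraMap C.CoordRing _ (Ideal.Quotient.mk _ (X i))

/-- The function field `Σ = L(C)`, generated over `L` by the quotients `xᵢ / xⱼ` of homogeneous
coordinates (where `xⱼ` does not vanish identically on `C`). -/
abbrev FunctionField : Type _ :=
  IntermediateField.adjoin L
    (Set.range fun ij : Fin 3 × Fin 3 => C.coord ij.1 / C.coord ij.2)

/-- The rational function `xᵢ / xⱼ` on `C`. -/
def ratio (i j : Fin 3) : C.FunctionField :=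
  ⟨C.coord i / C.coord j, IntermediateField.subset_adjoin _ _ ⟨(i, j), rfl⟩⟩

/-- The affine coordinate function `x = x₁ / x₃`. -/
def x : C.FunctionField := C.ratio 0 2

/-- The affine coordinate function `y = x₂ / x₃`. -/
def y : C.FunctionField := C.ratio 1 2

/-- The first component `y / x ^ (t - 1)` of `Φ`. -/
def phi₁ (t : ℕ) : C.FunctionField := C.y / C.x ^ (t - 1)

/-- The second component `y ^ (t - 1) / x ^ (t - 2)` of `Φ`. -/
def phi₂ (t : ℕ) : C.FunctionField := C.y ^ (t - 1) / C.x ^ (t - 2)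

/-- The subfield `Σ' = L(x', y')` of `Σ`, with `(x', y') = Φ(x, y)`. -/
def imageField (t : ℕ) : IntermediateField L C.FunctionField :=
  IntermediateField.adjoin L {C.phi₁ t, C.phi₂ t}

/-- `Φ` maps `C` onto a line or a conic: the ideal of the image is generated by a polynomial of
degree `1` or `2`. -/
def ImageIsConicOrLine (t : ℕ) : Prop :=
  ∃ Q : MvPolynomial (Fin 2) L, (Q.totalDegree = 1 ∨ Q.totalDegree = 2) ∧
    RingHom.ker (aeval (R := L) ![C.phi₁ t, C.phi₂ t]) = Ideal.span {Q}

/-- `P` is a linear branch of `C` centered at the vertex `Aᵢ` of the fundamental triangle, which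
the fundamental line `x_{i-1} = 0` (indices mod 3) meets with multiplicity `t - 1`.
The functions `x_{i+1} / xᵢ` and `x_{i+2} / xᵢ = x_{i-1} / xᵢ` are affine coordinates with origin
`Aᵢ`; the order of a branch centered at `Aᵢ` is the minimum of their orders. -/
def IsLinearBranchAtVertex (t : ℕ) (i : Fin 3) (P : Place L C.FunctionField) : Prop :=
  ∃ m l : ℤ, HasOrder P.ring (C.ratio (i + 1) i) m ∧ HasOrder P.ring (C.ratio (i + 2) i) l ∧
    min m l = 1 ∧ l = t - 1

/-- `C` is of the first type: at each vertex of the fundamental triangle there are centered two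
linear branches, each of which the tangent meets with multiplicity `t - 1`. The vertices are
double points of the curves in question, so for an irreducible curve the two branches are
distinct. A cyclic curve that is not of the first type is said to be of the second type. -/
def IsFirstType (t : ℕ) : Prop :=
  ∀ i : Fin 3, ∃ P₁ P₂ : Place L C.FunctionField, P₁ ≠ P₂ ∧
    C.IsLinearBranchAtVertex t i P₁ ∧ C.IsLinearBranchAtVertex t i P₂

/-- `C` is a cyclic curve with respect to the divisor `k` of `q² + q + 1`, where `q = |F|`, `L` is
an algebraic closure of `F`, and `ω` is a primitive element of the subfield of order `q³` of `L`;
its degree is `2 t` with `t = q - k + 2`. With `a = ω ^ (q - 1)` and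
`b = a ^ ((q² + q + 1) / k)`, the collineations are
`β : (x₁, x₂, x₃) ↦ (b x₁, b ^ (q + 1) x₂, x₃)` and `μ : (x₁, x₂, x₃) ↦ (x₃, x₁, x₂)`. -/
structure IsCyclicCurve (F : Type*) [Field F] [Algebra F L] (k t : ℕ) (ω : L)
    (C : IrredPlaneCurve L (2 * t)) : Prop where
  dvd : k ∣ Nat.card F ^ 2 + Nat.card F + 1
  lt : (2 / 3 : ℚ) * (Nat.card F + 2) < k
  degree : (t : ℤ) = Nat.card F - k + 2
  primitive : IsPrimitiveRoot ω (Nat.card F ^ 3 - 1)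
  /-- `C` is preserved by `β`. -/
  beta : ∀ b : L, b = (ω ^ (Nat.card F - 1)) ^ ((Nat.card F ^ 2 + Nat.card F + 1) / k) →
    ∃ c : L, c ≠ 0 ∧
      aeval (R := L) ![MvPolynomial.C b * X 0, MvPolynomial.C (b ^ (Nat.card F + 1)) * X 1,
        (X 2 : MvPolynomial (Fin 3) L)] C.eqn = MvPolynomial.C c * C.eqn
  /-- `C` is preserved by `μ`. -/
  mu : ∃ c : L, c ≠ 0 ∧
    aeval (R := L) ![X 2, X 0, (X 1 : MvPolynomial (Fin 3) L)] C.eqn = MvPolynomial.C c * C.eqn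
  /-- No fundamental line is a component of `C`. -/
  no_line : ∀ i : Fin 3, ¬ (X i ∣ C.eqn)
  /-- `C` is defined over `F`. -/
  defined : ∃ (c : L) (G : MvPolynomial (Fin 3) F), c ≠ 0 ∧
    C.eqn = MvPolynomial.C c * G.map (algebraMap F L)

end IrredPlaneCurve

end

/-! ### Comparing values under restriction of a valuation ring -/

section Valuations

variable {K : Type*} [Field K]

namespace ValuationSubring

/-! Put r = t - 2, N = r² + r + 1 = t² - 3t + 3, ξ = x' = y / x^(r+1) and η = y' = y^(r+1) / x^r.
Then x^N = η / ξ^(r+1) and y = ξ x^(r+1), so Σ = Σ'(x) with x^N in Σ'. Everything is read off from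
the zeros and poles of x^N on the image conic.

The equation. Clearing denominators in a polynomial of degree at most 2 in ξ, η gives a form of
degree 2t with six monomials (`conicForm`). If the image is a conic or a line, the equation of C
divides such a form, and the degrees agree. Under the bound on k, the divisibility k ∣ N forces k =
N; β then confines the exponents to one class modulo a lattice of index N, and μ together with the
absence of the component x₂ = 0 selects the class of these six monomials
(`exists_eq_conicForm_of_invariant`). Conversely, the image of such a curve is a conic: no line
contains it, since a form of degree t cannot be divisible by one of degree 2t.

Ramification. By μ and the absence of linear components, the pure squares of the conic have nonzero
coefficients, so it avoids the vertices. It is rational, and it meets each fundamental line in two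
points, or in one point of tangency, according to a discriminant which is the same for the three
lines. On the line η = 0 the function x^N has order ε = 1 or 2 there, prime to the odd number N;
hence one place lies above, the degree is N, and the exponent of the different is N - 1 because N is
invertible in L (`TotallyRamified`, `ConicVertex.exists_places`). The other two lines follow by
rotation (`ConicVertex.rotate`). Elsewhere x is a unit and nothing ramifies
(`isUniformizer_of_pow_valuation_eq_one`). The different therefore has order 6(N - 1) or 3(N - 1).
As x has order ε and y has order ε(r + 1) at the branches over η = 0, the first type is the case ε =
1. -/

theorem valuation_comap_le_iff {K' : Type*} [Field K'] (V : ValuationSubring K) (φ : K' →+* K)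
    (a b : K') : (V.comap φ).valuation a ≤ (V.comap φ).valuation b ↔
      V.valuation (φ a) ≤ V.valuation (φ b) := by
  by_cases hb : b = 0
  · subst hb
    simp
  · have h1 : (V.comap φ).valuation b ≠ 0 := by simpa using hb
    have h2 : V.valuation (φ b) ≠ 0 := by simpa using hb
    rw [← div_le_one₀ (zero_lt_iff.2 h1), ← div_le_one₀ (zero_lt_iff.2 h2), ← map_div₀,
      ← map_div₀, ← map_div₀, valuation_le_one_iff, valuation_le_one_iff, mem_comap]

theorem valuation_comap_lt_one_iff {K' : Type*} [Field K'] (V : ValuationSubring K)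
    (φ : K' →+* K) (a : K') : (V.comap φ).valuation a < 1 ↔ V.valuation (φ a) < 1 := by
  have := (V.valuation_comap_le_iff φ 1 a).not
  simpa using this

end ValuationSubring

theorem isUniformizer_comap_of_isUniformizer {K' : Type*} [Field K'] {V : ValuationSubring K}
    (φ : K' →+* K) {π : K'} (h : IsUniformizer V (φ π)) : IsUniformizer (V.comap φ) π := by
  refine ⟨fun h0 => h.1 (by simp [h0]), (V.valuation_comap_lt_one_iff φ π).2 h.2.1, fun f hf => ?_⟩
  rw [V.valuation_comap_lt_one_iff] at hf
  exact (V.valuation_comap_le_iff φ f π).2 (h.2.2 _ hf)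

theorem IsUniformizer.valuation_eq {V : ValuationSubring K} {π ρ : K} (h : IsUniformizer V π)
    (h' : IsUniformizer V ρ) : V.valuation π = V.valuation ρ :=
  le_antisymm (h'.2.2 _ h.2.1) (h.2.2 _ h'.2.1)

theorem HasOrder.unique {V : ValuationSubring K} {f : K} {m n : ℤ} (hm : HasOrder V f m)
    (hn : HasOrder V f n) : m = n := by
  obtain ⟨π, hπ, h1⟩ := hm
  obtain ⟨ρ, hρ, h2⟩ := hn
  rw [h1, hπ.valuation_eq hρ] at h2
  have h0 : 0 < V.valuation ρ := zero_lt_iff.2 (by simpa using hρ.1)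
  exact (zpow_right_strictAnti₀ h0 hρ.2.1).injective h2

end Valuations

/-! ### Places of L(z) and of its algebraic extensions -/

section RationalFunctionField

variable {L K : Type*} [Field L] [Field K] [Algebra L K]

theorem valuation_algebraMap_eq_one {V : ValuationSubring K} (hV : ∀ c : L, algebraMap L K c ∈ V)
    {c : L} (hc : c ≠ 0) : V.valuation (algebraMap L K c) = 1 := by
  refine le_antisymm ((V.valuation_le_one_iff _).2 (hV c)) ?_
  have h := (V.valuation_le_one_iff _).2 (hV c⁻¹)
  rw [map_inv₀, map_inv₀] at h
  have h0 : V.valuation (algebraMap L K c) ≠ 0 := by simpa using hc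
  exact (inv_le_one₀ (zero_lt_iff.2 h0)).1 h

theorem valuation_algebraMap_le_one {V : ValuationSubring K} (hV : ∀ c : L, algebraMap L K c ∈ V)
    (c : L) : V.valuation (algebraMap L K c) ≤ 1 :=
  (V.valuation_le_one_iff _).2 (hV c)

theorem valuation_eq_one_of_sub_algebraMap {V : ValuationSubring K}
    (hV : ∀ c : L, algebraMap L K c ∈ V) {w : K} {c : L} (hc : c ≠ 0)
    (h : V.valuation (w - algebraMap L K c) < 1) : V.valuation w = 1 := by
  have h1 := valuation_algebraMap_eq_one hV hc
  rw [← h1] at h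
  have := V.valuation.map_add_eq_of_lt_left h
  rwa [add_sub_cancel, h1] at this

theorem aeval_mem_valuationSubring {V : ValuationSubring K} (hV : ∀ c : L, algebraMap L K c ∈ V)
    {z : K} (hz : z ∈ V) (g : Polynomial L) : Polynomial.aeval z g ∈ V := by
  induction g using Polynomial.induction_on' with
  | add p q hp hq => rw [map_add]; exact V.add_mem _ _ hp hq
  | monomial n a =>
    rw [Polynomial.aeval_monomial]
    exact V.mul_mem _ _ (hV a) (pow_mem hz n)

/-- Splitting off the largest power of X fixes n and c from the polynomial alone, so they serve
every valuation ring with z in its maximal ideal. This uniformity later gives uniqueness of places.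
-/
theorem exists_leading_aeval {z : K} {g : Polynomial L} (hg : g ≠ 0) :
    ∃ (n : ℕ) (w : K) (c : L), c ≠ 0 ∧ Polynomial.aeval z g = z ^ n * w ∧
      ∀ V : ValuationSubring K, (∀ c : L, algebraMap L K c ∈ V) → V.valuation z < 1 →
        V.valuation (w - algebraMap L K c) < 1 := by
  obtain ⟨q, hq, hnd⟩ := Polynomial.exists_eq_pow_rootMultiplicity_mul_and_not_dvd g hg 0
  rw [Polynomial.C_0, sub_zero] at hq hnd
  refine ⟨g.rootMultiplicity 0, Polynomial.aeval z q, q.coeff 0, ?_, ?_, ?_⟩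
  · rwa [ne_eq, ← Polynomial.X_dvd_iff]
  · conv_lhs => rw [hq]
    simp
  · intro V hV hz
    have : Polynomial.aeval z q - algebraMap L K (q.coeff 0) = Polynomial.aeval z q.divX * z := by
      conv_lhs => rw [← Polynomial.divX_mul_X_add q]
      simp
    rw [this, map_mul]
    exact (mul_le_of_le_one_left' ((V.valuation_le_one_iff _).2
      (aeval_mem_valuationSubring hV ((V.valuation_le_one_iff _).1 hz.le) _))).trans_lt hz

/-- Every nonzero rational function of `z` is a power of `z` times a function whose residue at
`z = 0` is a nonzero constant. -/
theorem exists_leading {z f : K} (hf : f ∈ IntermediateField.adjoin L {z}) (hf0 : f ≠ 0) :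
    ∃ (n : ℤ) (w : K) (c : L), c ≠ 0 ∧ f = z ^ n * w ∧
      ∀ V : ValuationSubring K, (∀ c : L, algebraMap L K c ∈ V) → V.valuation z < 1 →
        V.valuation (w - algebraMap L K c) < 1 := by
  by_cases hz : z = 0
  · subst hz
    rw [IntermediateField.adjoin_zero, IntermediateField.mem_bot] at hf
    obtain ⟨c, rfl⟩ := hf
    exact ⟨0, algebraMap L K c, c, by rintro rfl; simp at hf0, by simp, by simp⟩
  obtain ⟨r, s, rfl⟩ := (IntermediateField.mem_adjoin_simple_iff L f).1 hf
  have hr : r ≠ 0 := by rintro rfl; simp at hf0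
  have hs : s ≠ 0 := by rintro rfl; simp at hf0
  obtain ⟨m, w, c, hc, h1, h2⟩ := exists_leading_aeval (z := z) hr
  obtain ⟨m', w', c', hc', h1', h2'⟩ := exists_leading_aeval (z := z) hs
  have hw' : w' ≠ 0 := by
    rintro rfl
    rw [h1'] at hf0
    simp at hf0
  refine ⟨m - m', w / w', c / c', div_ne_zero hc hc', ?_, fun V hV hz1 => ?_⟩
  · rw [h1, h1', zpow_sub₀ hz, zpow_natCast, zpow_natCast]
    field_simp
  · have hc'' : algebraMap L K c' ≠ 0 := by simpa using hc'
    have e : w / w' - algebraMap L K (c / c') =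
        ((w - algebraMap L K c) * algebraMap L K c' - algebraMap L K c * (w' - algebraMap L K c'))
          / (w' * algebraMap L K c') := by
      rw [map_div₀]
      field_simp
      ring
    rw [e, map_div₀, map_mul, valuation_eq_one_of_sub_algebraMap hV hc' (h2' V hV hz1),
      valuation_algebraMap_eq_one hV hc', one_mul, div_one]
    refine V.valuation.map_sub_lt ?_ ?_
    · rw [map_mul, valuation_algebraMap_eq_one hV hc', mul_one]
      exact h2 V hV hz1
    · rw [map_mul, valuation_algebraMap_eq_one hV hc, one_mul]
      exact h2' V hV hz1

theorem adjoin_simple_inv (z : K) :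
    IntermediateField.adjoin L {z⁻¹} = IntermediateField.adjoin L {z} := by
  refine le_antisymm ?_ ?_ <;> rw [IntermediateField.adjoin_simple_le_iff]
  · exact inv_mem (IntermediateField.mem_adjoin_simple_self L z)
  · have := inv_mem (IntermediateField.mem_adjoin_simple_self L z⁻¹)
    rwa [inv_inv] at this

theorem adjoin_simple_sub_algebraMap (z : K) (c : L) :
    IntermediateField.adjoin L {z - algebraMap L K c} = IntermediateField.adjoin L {z} := by
  refine le_antisymm ?_ ?_ <;> rw [IntermediateField.adjoin_simple_le_iff]
  · exact sub_mem (IntermediateField.mem_adjoin_simple_self L z)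
      (IntermediateField.algebraMap_mem _ c)
  · have := add_mem (IntermediateField.mem_adjoin_simple_self L (z - algebraMap L K c))
      (IntermediateField.algebraMap_mem _ c)
    rwa [sub_add_cancel] at this

/-- A place of an algebraic extension of `L(s)` lies over `s = c` or over `s = ∞`. -/
theorem Place.exists_lt_one [IsAlgClosed L] (P : Place L K) (s : K)
    [Algebra.IsAlgebraic (IntermediateField.adjoin L {s}) K] :
    1 < P.ring.valuation s ∨ ∃ c : L, P.ring.valuation (s - algebraMap L K c) < 1 := by
  by_contra! hcon
  obtain ⟨hs, hc⟩ := hcon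
  set v := P.ring.valuation
  have hle : ∀ c : L, v (s - algebraMap L K c) = 1 := fun c =>
    le_antisymm (v.map_sub_le hs (valuation_algebraMap_le_one P.algebraMap_mem c)) (hc c)
  -- Over an algebraically closed field a polynomial in s is a product of factors s - c, all of
  -- value 1 here. So L(s) lies in the valuation ring, which is integrally closed and hence all of
  -- K.
  have hpoly : ∀ g : Polynomial L, g ≠ 0 → v (Polynomial.aeval s g) = 1 := by
    intro g hg
    have h0 := (IsAlgClosed.splits g).eq_prod_roots
    rw [h0, map_mul, map_mul, Polynomial.aeval_C, valuation_algebraMap_eq_one P.algebraMap_mem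
      (by simpa using hg), one_mul, map_multiset_prod, map_multiset_prod, Multiset.map_map,
      Multiset.map_map]
    refine Multiset.prod_eq_one fun x hx => ?_
    obtain ⟨c, -, rfl⟩ := Multiset.mem_map.1 hx
    simpa using hle c
  have hL : ∀ f ∈ IntermediateField.adjoin L {s}, f ∈ P.ring := by
    intro f hf
    by_cases hf0 : f = 0
    · rw [hf0]; exact zero_mem _
    obtain ⟨r, q, rfl⟩ := (IntermediateField.mem_adjoin_simple_iff L f).1 hf
    have hr : r ≠ 0 := by rintro rfl; simp at hf0
    have hq : q ≠ 0 := by rintro rfl; simp at hf0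
    rw [← P.ring.valuation_le_one_iff, map_div₀, hpoly r hr, hpoly q hq, div_one]
  refine P.ne_top (top_unique fun g _ => ?_)
  let φ : IntermediateField.adjoin L {s} →+* P.ring :=
    { toFun := fun f => ⟨f, hL f f.2⟩
      map_one' := rfl
      map_mul' := fun _ _ => rfl
      map_zero' := rfl
      map_add' := fun _ _ => rfl }
  have hg : IsIntegral (IntermediateField.adjoin L {s}) g :=
    (Algebra.IsAlgebraic.isAlgebraic g).isIntegral
  obtain ⟨m, hm, hm0⟩ := hg
  have : IsIntegral P.ring g := by
    refine ⟨m.map φ, hm.map φ, ?_⟩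
    rw [Polynomial.eval₂_map]
    exact hm0
  obtain ⟨y, rfl⟩ := IsIntegrallyClosed.isIntegral_iff.1 this
  exact y.2

theorem Place.exists_generator [IsAlgClosed L] (P : Place L K) (s : K)
    [Algebra.IsAlgebraic (IntermediateField.adjoin L {s}) K] :
    ∃ z : K, P.ring.valuation z < 1 ∧
      IntermediateField.adjoin L {z} = IntermediateField.adjoin L {s} := by
  rcases P.exists_lt_one s with h | ⟨c, hc⟩
  · exact ⟨s⁻¹, by rw [map_inv₀]; exact inv_lt_one_of_one_lt₀ h, adjoin_simple_inv s⟩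
  · exact ⟨_, hc, adjoin_simple_sub_algebraMap s c⟩

/-- There is a place at which a given transcendental function vanishes. -/
theorem Place.exists_of_transcendental {z : K} (hz : Transcendental L z) :
    ∃ P : Place L K, P.ring.valuation z < 1 := by
  -- The ideal (z) of L[z] is proper, so some valuation ring contains L[z] and has z as a nonunit.
  let A : Subring K := (Algebra.adjoin L {z}).toSubring
  have hzA : z ∈ A := Algebra.self_mem_adjoin_singleton L z
  have hI : Ideal.span {(⟨z, hzA⟩ : A)} ≠ ⊤ := by
    rw [ne_eq, Ideal.span_singleton_eq_top]
    intro hu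
    obtain ⟨⟨w, hw⟩, hw'⟩ := hu.exists_right_inv
    have hw1 : z * w = 1 := congrArg Subtype.val hw'
    change w ∈ Algebra.adjoin L {z} at hw
    rw [Algebra.adjoin_singleton_eq_range_aeval] at hw
    obtain ⟨g, rfl⟩ := hw
    refine hz ⟨Polynomial.X * g - 1, fun h0 => ?_, ?_⟩
    · have := congrArg (Polynomial.eval 0) h0
      simp at this
    · have hw1' : z * Polynomial.aeval z g = 1 := hw1
      simp [hw1']
  obtain ⟨V, hAV, hV⟩ := Ideal.image_subset_nonunits_valuationSubring _ hI
  have hzV : V.valuation z < 1 :=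
    (ValuationSubring.mem_nonunits_iff V).1 (hV ⟨⟨z, hzA⟩, Ideal.subset_span rfl, rfl⟩)
  refine ⟨⟨V, fun c => hAV ((Algebra.adjoin L {z}).algebraMap_mem c), ?_⟩, hzV⟩
  rintro rfl
  have hz0 : z ≠ 0 := by
    rintro rfl
    exact hz isAlgebraic_zero
  have h1 := (ValuationSubring.valuation_le_one_iff (⊤ : ValuationSubring K) z⁻¹).2 trivial
  rw [map_inv₀, inv_le_one₀ (zero_lt_iff.2 (by simpa using hz0))] at h1
  exact absurd hzV (not_lt.2 h1)

end RationalFunctionField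

/-! ### Totally and tamely ramified radical extensions -/

section Kummer

variable {L K : Type*} [Field L] [Field K] [Algebra L K]

theorem exists_eq_sum_range_mul_pow {K' : IntermediateField L K} {x : K} {N : ℕ} (hN : 0 < N)
    (hx : x ^ N ∈ K') (htop : IntermediateField.adjoin K' {x} = ⊤) (f : K) :
    ∃ a : ℕ → K, (∀ i, a i ∈ K') ∧ f = ∑ i ∈ Finset.range N, a i * x ^ i := by
  set M : Polynomial K' := Polynomial.X ^ N - Polynomial.C ⟨x ^ N, hx⟩ with hM
  have hmon : M.Monic := Polynomial.monic_X_pow_sub_C _ hN.ne'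
  have hroot : Polynomial.aeval x M = 0 := by
    simp [hM, IntermediateField.algebraMap_apply]
  have hint : IsIntegral K' x := ⟨M, hmon, hroot⟩
  have hf : f ∈ Algebra.adjoin K' {x} := by
    rw [← IntermediateField.adjoin_simple_toSubalgebra_of_isAlgebraic hint.isAlgebraic, htop]
    trivial
  rw [Algebra.adjoin_singleton_eq_range_aeval] at hf
  obtain ⟨g, rfl⟩ := hf
  refine ⟨fun i => ((g %ₘ M).coeff i : K), fun i => ((g %ₘ M).coeff i).2, ?_⟩
  have h1 : Polynomial.aeval x g = Polynomial.aeval x (g %ₘ M) := by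
    conv_lhs => rw [← Polynomial.modByMonic_add_div g M]
    simp [hroot]
  have hdeg : (g %ₘ M).natDegree < N := by
    have h2 : M.natDegree = N := Polynomial.natDegree_X_pow_sub_C
    have h3 : M ≠ 1 := fun h => by
      rw [h, Polynomial.natDegree_one] at h2
      omega
    calc _ < M.natDegree := Polynomial.natDegree_modByMonic_lt g hmon h3
      _ = N := h2
  change Polynomial.aeval x g = _
  rw [h1, Polynomial.aeval_eq_sum_range' hdeg]
  exact Finset.sum_congr rfl fun i _ => by rw [Algebra.smul_def]; rfl

/-- `K = K'(x)` with `K' = L(z)` and `x ^ N ∈ K'` of order `n` prime to `N` at `z = 0`. -/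
structure TotallyRamified (K' : IntermediateField L K) (z x : K) (N : ℕ) (n α β : ℤ) : Prop where
  gen : IntermediateField.adjoin L {z} = K'
  z_ne : z ≠ 0
  x_ne : x ≠ 0
  pos : 0 < N
  mem : x ^ N ∈ K'
  top : IntermediateField.adjoin K' {x} = ⊤
  bezout : α * n + β * N = 1
  val : ∀ V : ValuationSubring K, (∀ c : L, algebraMap L K c ∈ V) → V.valuation z < 1 →
    V.valuation x ^ N = V.valuation z ^ n

namespace TotallyRamified

variable {K' : IntermediateField L K} {z x : K} {N : ℕ} {n α β : ℤ}

theorem uniformizer_ne_zero (h : TotallyRamified K' z x N n α β) : x ^ α * z ^ β ≠ 0 :=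
  mul_ne_zero (zpow_ne_zero _ h.x_ne) (zpow_ne_zero _ h.z_ne)

/-- By the Bézout relation, the N-th power has the value of z^(αn + βN) = z. -/
theorem valuation_uniformizer_pow (h : TotallyRamified K' z x N n α β) {V : ValuationSubring K}
    (hV : ∀ c : L, algebraMap L K c ∈ V) (hz : V.valuation z < 1) :
    V.valuation (x ^ α * z ^ β) ^ N = V.valuation z := by
  have hz0 : V.valuation z ≠ 0 := by simpa using h.z_ne
  rw [map_mul, map_zpow₀, map_zpow₀, mul_pow, ← zpow_natCast, ← zpow_natCast, zpow_comm,
    zpow_natCast, h.val V hV hz, ← zpow_mul, ← zpow_mul, ← zpow_add₀ hz0]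
  rw [mul_comm n, h.bezout, zpow_one]

theorem valuation_uniformizer_lt_one (h : TotallyRamified K' z x N n α β)
    {V : ValuationSubring K} (hV : ∀ c : L, algebraMap L K c ∈ V) (hz : V.valuation z < 1) :
    V.valuation (x ^ α * z ^ β) < 1 := by
  rw [← h.valuation_uniformizer_pow hV hz] at hz
  exact lt_of_not_ge fun hge => absurd hz (not_lt.2 (one_le_pow₀ hge))

theorem valuation_eq (h : TotallyRamified K' z x N n α β) {V : ValuationSubring K}
    (hV : ∀ c : L, algebraMap L K c ∈ V) (hz : V.valuation z < 1) :
    V.valuation x = V.valuation (x ^ α * z ^ β) ^ n := by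
  refine (pow_left_inj₀ zero_le zero_le h.pos.ne').1 ?_
  rw [h.val V hV hz, ← h.valuation_uniformizer_pow hV hz, ← zpow_natCast, ← zpow_natCast,
    zpow_comm]

/-- In terms of the uniformizer, the term with index i has order N m_i + n i. Since n is prime to N,
these orders differ modulo N for i < N, so a single term dominates. The exponent m does not depend
on V. -/
theorem valuation_sum (h : TotallyRamified K' z x N n α β) {a : ℕ → K} (ha : ∀ i, a i ∈ K')
    (hne : ∃ i < N, a i ≠ 0) :
    ∃ m : ℤ, ∀ V : ValuationSubring K, (∀ c : L, algebraMap L K c ∈ V) → V.valuation z < 1 →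
      V.valuation (∑ i ∈ Finset.range N, a i * x ^ i) = V.valuation (x ^ α * z ^ β) ^ m := by
  have hlead : ∀ i, ∃ m : ℤ, a i ≠ 0 → ∀ V : ValuationSubring K,
      (∀ c : L, algebraMap L K c ∈ V) → V.valuation z < 1 →
      V.valuation (a i) = V.valuation z ^ m := by
    intro i
    by_cases hi : a i = 0
    · exact ⟨0, fun h => absurd hi h⟩
    · obtain ⟨m, w, c, hc, h1, h2⟩ := exists_leading (h.gen ▸ ha i) hi
      refine ⟨m, fun _ V hV hz => ?_⟩
      rw [h1, map_mul, map_zpow₀, valuation_eq_one_of_sub_algebraMap hV hc (h2 V hV hz), mul_one]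
  choose m hm using hlead
  have hterm : ∀ i, a i ≠ 0 → ∀ V : ValuationSubring K,
      (∀ c : L, algebraMap L K c ∈ V) → V.valuation z < 1 →
      V.valuation (a i * x ^ i) = V.valuation (x ^ α * z ^ β) ^ (N * m i + n * i) := by
    intro i hi V hV hz
    have h0 : V.valuation (x ^ α * z ^ β) ≠ 0 := by
      rw [Valuation.ne_zero_iff]
      exact h.uniformizer_ne_zero
    rw [map_mul, map_pow, hm i hi V hV hz, h.valuation_eq hV hz, zpow_add₀ h0, zpow_mul, zpow_mul,
      zpow_natCast, zpow_natCast, h.valuation_uniformizer_pow hV hz]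
  classical
  obtain ⟨j₀, hj₀, hj₀'⟩ := hne
  obtain ⟨j, hj, hmin⟩ := Finset.exists_min_image ((Finset.range N).filter fun i => a i ≠ 0)
    (fun i => N * m i + n * i) ⟨j₀, by simp [hj₀, hj₀']⟩
  rw [Finset.mem_filter, Finset.mem_range] at hj
  refine ⟨N * m j + n * j, fun V hV hz => ?_⟩
  rw [← hterm j hj.2 V hV hz]
  refine V.valuation.map_sum_eq_of_lt (Finset.mem_range.2 hj.1) fun i hi => ?_
  rw [Finset.mem_sdiff, Finset.mem_range, Finset.mem_singleton] at hi
  have hτ0 : 0 < V.valuation (x ^ α * z ^ β) :=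
    zero_lt_iff.2 (by rw [Valuation.ne_zero_iff]; exact h.uniformizer_ne_zero)
  by_cases hi0 : a i = 0
  · rw [hi0, zero_mul, map_zero, hterm j hj.2 V hV hz]
    exact zpow_pos hτ0 _
  · rw [hterm j hj.2 V hV hz, hterm i hi0 V hV hz]
    refine zpow_right_strictAnti₀ hτ0 (h.valuation_uniformizer_lt_one hV hz) ?_
    refine lt_of_le_of_ne (hmin i (by simp [hi.1, hi0])) fun heq => hi.2 ?_
    have hdvd : (N : ℤ) ∣ n * ((i : ℤ) - j) := ⟨m j - m i, by linear_combination -heq⟩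
    have hcop : IsCoprime (N : ℤ) n := ⟨β, α, by linear_combination h.bezout⟩
    have hdvd' := hcop.dvd_of_dvd_mul_left hdvd
    have hi1 : i < N := hi.1
    have hj1 : j < N := hj.1
    have := Int.eq_zero_of_abs_lt_dvd hdvd' (by rw [abs_lt]; constructor <;> omega)
    omega

theorem exists_valuation_eq (h : TotallyRamified K' z x N n α β) {f : K} (hf : f ≠ 0) :
    ∃ m : ℤ, ∀ V : ValuationSubring K, (∀ c : L, algebraMap L K c ∈ V) → V.valuation z < 1 →
      V.valuation f = V.valuation (x ^ α * z ^ β) ^ m := by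
  obtain ⟨a, ha, rfl⟩ := exists_eq_sum_range_mul_pow h.pos h.mem h.top f
  refine h.valuation_sum ha ?_
  by_contra! hcon
  exact hf (Finset.sum_eq_zero fun i hi => by rw [hcon i (Finset.mem_range.1 hi), zero_mul])

theorem isUniformizer (h : TotallyRamified K' z x N n α β) {V : ValuationSubring K}
    (hV : ∀ c : L, algebraMap L K c ∈ V) (hz : V.valuation z < 1) :
    IsUniformizer V (x ^ α * z ^ β) := by
  have hlt := h.valuation_uniformizer_lt_one hV hz
  refine ⟨h.uniformizer_ne_zero, hlt, fun f hf => ?_⟩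
  by_cases hf0 : f = 0
  · simp [hf0]
  obtain ⟨m, hm⟩ := h.exists_valuation_eq hf0
  rw [hm V hV hz] at hf ⊢
  have h0 : 0 < V.valuation (x ^ α * z ^ β) :=
    zero_lt_iff.2 (by rw [Valuation.ne_zero_iff]; exact h.uniformizer_ne_zero)
  have hm1 : 0 < m := by
    by_contra! hcon
    exact absurd hf (not_lt.2 (one_le_zpow_of_nonpos₀ h0 hlt.le hcon))
  calc _ ≤ V.valuation (x ^ α * z ^ β) ^ (1 : ℤ) :=
        (zpow_right_strictAnti₀ h0 hlt).antitone (by omega)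
    _ = _ := zpow_one _

/-- Every nonzero function has the same order at all places over z = 0, so these places have the
same ring. -/
theorem place_unique (h : TotallyRamified K' z x N n α β) {P Q : Place L K}
    (hP : P.ring.valuation z < 1) (hQ : Q.ring.valuation z < 1) : P = Q := by
  have key : ∀ V W : Place L K, V.ring.valuation z < 1 → W.ring.valuation z < 1 →
      V.ring ≤ W.ring := by
    intro V W hV hW f hf
    by_cases hf0 : f = 0
    · rw [hf0]; exact zero_mem _
    obtain ⟨m, hm⟩ := h.exists_valuation_eq hf0
    rw [← ValuationSubring.valuation_le_one_iff, hm _ V.algebraMap_mem hV] at hf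
    rw [← ValuationSubring.valuation_le_one_iff, hm _ W.algebraMap_mem hW]
    have hm0 : 0 ≤ m := by
      by_contra! hcon
      refine absurd hf (not_le.2 (one_lt_zpow_of_neg₀ (zero_lt_iff.2 ?_)
        (h.valuation_uniformizer_lt_one V.algebraMap_mem hV) hcon))
      rw [Valuation.ne_zero_iff]; exact h.uniformizer_ne_zero
    obtain ⟨m, rfl⟩ := Int.eq_ofNat_of_zero_le hm0
    rw [zpow_natCast]
    exact pow_le_one₀ zero_le (h.valuation_uniformizer_lt_one W.algebraMap_mem hW).le
  cases P
  cases Q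
  congr
  exact le_antisymm (key _ _ hP hQ) (key _ _ hQ hP)

/-- A minimal polynomial of x of degree below N would be a vanishing combination of 1, x, ...,
x^(N-1), contrary to `valuation_sum` at P. -/
theorem finrank_eq (h : TotallyRamified K' z x N n α β) {P : Place L K}
    (hP : P.ring.valuation z < 1) : Module.finrank K' K = N := by
  have hroot : Polynomial.aeval x (Polynomial.X ^ N - Polynomial.C ⟨x ^ N, h.mem⟩ :
      Polynomial K') = 0 := by
    simp [IntermediateField.algebraMap_apply]
  have hint : IsIntegral K' x := ⟨_, Polynomial.monic_X_pow_sub_C _ h.pos.ne', hroot⟩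
  have h1 : Module.finrank K' K = (minpoly K' x).natDegree := by
    rw [← IntermediateField.adjoin.finrank hint, h.top, IntermediateField.finrank_top']
  rw [h1]
  have hle : (minpoly K' x).natDegree ≤ N := by
    have := Polynomial.natDegree_le_of_dvd (minpoly.dvd K' x hroot)
      (Polynomial.monic_X_pow_sub_C _ h.pos.ne').ne_zero
    rwa [Polynomial.natDegree_X_pow_sub_C] at this
  refine le_antisymm hle (not_lt.1 fun hlt => ?_)
  obtain ⟨m, hm⟩ := h.valuation_sum (a := fun i => ((minpoly K' x).coeff i : K))
    (fun i => ((minpoly K' x).coeff i).2) ⟨(minpoly K' x).natDegree, hlt, by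
      have : (minpoly K' x).coeff (minpoly K' x).natDegree = 1 := (minpoly.monic hint)
      rw [this]
      simp⟩
  have hm := hm _ P.algebraMap_mem hP
  have h0 : ∑ i ∈ Finset.range N, ((minpoly K' x).coeff i : K) * x ^ i = 0 := by
    rw [← minpoly.aeval K' x, Polynomial.aeval_eq_sum_range' hlt]
    exact Finset.sum_congr rfl fun i _ => by rw [Algebra.smul_def]; rfl
  rw [h0, map_zero] at hm
  refine zpow_ne_zero m ?_ hm.symm
  rw [Valuation.ne_zero_iff]
  exact h.uniformizer_ne_zero

theorem hasOrder (h : TotallyRamified K' z x N n α β) {P : Place L K}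
    (hP : P.ring.valuation z < 1) : HasOrder P.ring x n :=
  ⟨_, h.isUniformizer P.algebraMap_mem hP, h.valuation_eq P.algebraMap_mem hP⟩

/-- With τ = x^α z^β, the function τ^N lies in K' and has the value of z, so it is a parameter
below. From d(τ^N) = N τ^(N-1) dτ the exponent N - 1 is immediate, N being a unit. -/
theorem isDifferentExponent (h : TotallyRamified K' z x N n α β) (hN : (N : L) ≠ 0)
    {P : Place L K} (hP : P.ring.valuation z < 1) : IsDifferentExponent K' P ((N : ℤ) - 1) := by
  have hu := h.isUniformizer P.algebraMap_mem hP
  have hmem : (x ^ α * z ^ β) ^ N ∈ K' := by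
    rw [mul_pow, ← zpow_natCast, zpow_comm, zpow_natCast]
    exact mul_mem (zpow_mem h.mem α) (pow_mem (zpow_mem
      (h.gen ▸ IntermediateField.mem_adjoin_simple_self L z) β) N)
  refine ⟨x ^ α * z ^ β, ⟨_, hmem⟩, N * (x ^ α * z ^ β) ^ (N - 1), hu, ⟨?_, ?_, fun f hf => ?_⟩,
    ?_, _, hu, ?_⟩
  · intro h0
    exact pow_ne_zero N hu.1 (congrArg Subtype.val h0)
  · rw [ValuationSubring.valuation_comap_lt_one_iff]
    change P.ring.valuation ((x ^ α * z ^ β) ^ N) < 1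
    rwa [map_pow, h.valuation_uniformizer_pow P.algebraMap_mem hP]
  · rw [ValuationSubring.valuation_comap_lt_one_iff] at hf
    rw [ValuationSubring.valuation_comap_le_iff]
    change P.ring.valuation (f : K) ≤ P.ring.valuation ((x ^ α * z ^ β) ^ N)
    change P.ring.valuation (f : K) < 1 at hf
    rw [map_pow, h.valuation_uniformizer_pow P.algebraMap_mem hP]
    by_cases hf0 : (f : K) = 0
    · simp [hf0]
    obtain ⟨m, w, c, hc, h1, h2⟩ := exists_leading (h.gen.ge f.2) hf0
    have hz0 : 0 < P.ring.valuation z := zero_lt_iff.2 (by simpa using h.z_ne)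
    rw [h1, map_mul, map_zpow₀, valuation_eq_one_of_sub_algebraMap P.algebraMap_mem hc
      (h2 _ P.algebraMap_mem hP), mul_one] at hf ⊢
    have hm1 : 0 < m := by
      by_contra! hcon
      exact absurd hf (not_lt.2 (one_le_zpow_of_nonpos₀ hz0 hP.le hcon))
    calc _ ≤ P.ring.valuation z ^ (1 : ℤ) :=
          (zpow_right_strictAnti₀ hz0 hP).antitone (by omega)
      _ = _ := zpow_one _
  · change KaehlerDifferential.D L K ((x ^ α * z ^ β) ^ N) = _
    rw [Derivation.leibniz_pow, ← Nat.cast_smul_eq_nsmul K, smul_smul]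
  · have hN' : P.ring.valuation (N : K) = 1 := by
      rw [← map_natCast (algebraMap L K)]
      exact valuation_algebraMap_eq_one P.algebraMap_mem hN
    have hc : (N : ℤ) - 1 = ((N - 1 : ℕ) : ℤ) := by have := h.pos; omega
    rw [map_mul, hN', one_mul, hc, zpow_natCast, map_pow]

end TotallyRamified

end Kummer

/-! ### Radical extensions where the radicand is a unit -/

section Unramified

variable {L K : Type*} [Field L] [Field K] [Algebra L K]

/-- If `x ^ N` is a unit at a place over `z = 0`, then `z` remains a uniformizer in `K'(x)`. -/
theorem isUniformizer_of_pow_valuation_eq_one [IsAlgClosed L] {K' : IntermediateField L K}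
    {z x : K} {N : ℕ} (hgen : IntermediateField.adjoin L {z} = K') (hz0 : z ≠ 0) (hN : (N : L) ≠ 0)
    (hmem : x ^ N ∈ K') (htop : IntermediateField.adjoin K' {x} = ⊤) {V : ValuationSubring K}
    (hV : ∀ c : L, algebraMap L K c ∈ V) (hz : V.valuation z < 1)
    (hx1 : V.valuation x = 1) : IsUniformizer V z := by
  have hNpos : 0 < N := Nat.pos_of_ne_zero (by rintro rfl; simp at hN)
  have hzK' : z ∈ K' := hgen ▸ IntermediateField.mem_adjoin_simple_self L z
  have hvz : 0 < V.valuation z := zero_lt_iff.2 (by simpa using hz0)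
  -- O is the local ring of K' below V, with maximal ideal generated by z.
  let O : Subring K := K'.toSubfield.toSubring ⊓ V.toSubring
  have hO : ∀ f, f ∈ O ↔ f ∈ K' ∧ V.valuation f ≤ 1 := fun f => by
    rw [ValuationSubring.valuation_le_one_iff]
    exact Iff.rfl
  have hdiv : ∀ a ∈ O, V.valuation a < 1 → ∃ b ∈ O, a = z * b := by
    intro a ha ha1
    refine ⟨a / z, (hO _).2 ⟨div_mem ((hO _).1 ha).1 hzK', ?_⟩, by field_simp⟩
    by_cases ha0 : a = 0
    · simp [ha0]
    obtain ⟨m, w, c, hc, h1, h2⟩ := exists_leading (hgen ▸ ((hO _).1 ha).1) ha0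
    have hva : V.valuation a = V.valuation z ^ m := by
      rw [h1, map_mul, map_zpow₀, valuation_eq_one_of_sub_algebraMap hV hc (h2 V hV hz), mul_one]
    rw [map_div₀, hva, div_le_one₀ hvz]
    have hm1 : 0 < m := by
      by_contra! hcon
      rw [hva] at ha1
      exact absurd ha1 (not_lt.2 (one_le_zpow_of_nonpos₀ hvz hz.le hcon))
    calc _ ≤ V.valuation z ^ (1 : ℤ) := (zpow_right_strictAnti₀ hvz hz).antitone (by omega)
      _ = _ := zpow_one _
  have hcO : ∀ c : L, algebraMap L K c ∈ O := fun c =>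
    (hO _).2 ⟨K'.algebraMap_mem c, valuation_algebraMap_le_one hV c⟩
  have hx0 : x ≠ 0 := by
    rintro rfl
    simp at hx1
  -- the residue of `x`
  obtain ⟨ξ, hξ0, hξ, hξN⟩ : ∃ ξ : L, ξ ≠ 0 ∧ V.valuation (x - algebraMap L K ξ) < 1 ∧
      V.valuation (x ^ N - algebraMap L K (ξ ^ N)) < 1 := by
    obtain ⟨m, w, c, hc, h1, h2⟩ := exists_leading (hgen ▸ hmem) (pow_ne_zero N hx0)
    have hw := valuation_eq_one_of_sub_algebraMap hV hc (h2 V hV hz)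
    have hm : m = 0 := by
      have h3 : V.valuation (x ^ N) = 1 := by rw [map_pow, hx1, one_pow]
      rw [h1, map_mul, map_zpow₀, hw, mul_one] at h3
      exact (zpow_right_strictAnti₀ hvz hz).injective (by rw [h3, zpow_zero])
    rw [hm, zpow_zero, one_mul] at h1
    have h2 := h2 V hV hz
    rw [← h1] at h2
    -- x^N - c is the product of x - a over the N-th roots a of c. It has value below 1, so one
    -- factor does too, and its a is the residue of x.
    have hsplit : (Polynomial.X ^ N - Polynomial.C c) =
        ((Polynomial.X ^ N - Polynomial.C c).roots.map fun a =>
          Polynomial.X - Polynomial.C a).prod :=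
      (IsAlgClosed.splits _).eq_prod_roots_of_monic (Polynomial.monic_X_pow_sub_C c hNpos.ne')
    have hprod := congrArg (fun g => V.valuation (Polynomial.aeval x g)) hsplit
    simp only [map_sub, map_pow, Polynomial.aeval_X, Polynomial.aeval_C, map_multiset_prod,
      Multiset.map_map] at hprod
    by_contra! hcon
    rw [hprod] at h2
    refine absurd h2 (not_lt.2 (Multiset.one_le_prod_of_one_le ?_))
    intro y hy
    obtain ⟨a, ha, rfl⟩ := Multiset.mem_map.1 hy
    have haN : a ^ N = c := by
      rw [Polynomial.mem_roots (Polynomial.monic_X_pow_sub_C c hNpos.ne').ne_zero] at ha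
      simpa [sub_eq_zero] using ha
    have ha0 : a ≠ 0 := by
      rintro rfl
      exact hc (by rw [← haN, zero_pow hNpos.ne'])
    simp only [Function.comp, Polynomial.aeval_X, Polynomial.aeval_C, map_sub]
    by_contra! hlt
    have := hcon a ha0 hlt
    rw [haN, hprod] at this
    exact absurd h2 (not_lt.2 this)
  set e := algebraMap L K ξ with he
  -- `x ^ N - ξ ^ N = (x - ξ) * M` with `M` a unit
  set M := ∑ i ∈ Finset.range N, x ^ i * e ^ (N - 1 - i) with hM
  have hMe : M * (x - e) = x ^ N - e ^ N := (Commute.all x e).geom_sum₂_mul N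
  have hve : V.valuation e = 1 := valuation_algebraMap_eq_one hV hξ0
  -- M has residue N ξ^(N-1), which is nonzero because N is invertible in L.
  have hVM : V.valuation M = 1 := by
    have hval : (N : L) * ξ ^ (N - 1) ≠ 0 := mul_ne_zero hN (pow_ne_zero _ hξ0)
    refine valuation_eq_one_of_sub_algebraMap hV hval ?_
    have : M - algebraMap L K (N * ξ ^ (N - 1)) =
        ∑ i ∈ Finset.range N, (x ^ i - e ^ i) * e ^ (N - 1 - i) := by
      rw [hM, map_mul, map_natCast, map_pow, ← he]
      have h3 : ∑ i ∈ Finset.range N, e ^ i * e ^ (N - 1 - i) = (N : K) * e ^ (N - 1) := by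
        rw [Finset.sum_congr rfl fun i hi => ?_, Finset.sum_const, Finset.card_range,
          nsmul_eq_mul]
        rw [← pow_add]
        congr 1
        have := Finset.mem_range.1 hi
        omega
      rw [← h3, ← Finset.sum_sub_distrib]
      exact Finset.sum_congr rfl fun i _ => by ring
    rw [this]
    refine V.valuation.map_sum_lt one_ne_zero fun i _ => ?_
    rw [map_mul, map_pow _ e, hve, one_pow, mul_one]
    obtain ⟨g, hg⟩ := sub_dvd_pow_sub_pow (⟨x, (V.valuation_le_one_iff _).1 hx1.le⟩ : V)
      ⟨e, hV ξ⟩ i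
    have hg' : x ^ i - e ^ i = (x - e) * g := congrArg Subtype.val hg
    rw [hg', map_mul]
    exact (mul_le_of_le_one_right' ((V.valuation_le_one_iff _).2 g.2)).trans_lt hξ
  obtain ⟨b, hb, hbe⟩ : ∃ b ∈ O, x ^ N - e ^ N = z * b := by
    refine hdiv _ (sub_mem ((hO _).2 ⟨hmem, ?_⟩) (pow_mem (hcO ξ) N)) ?_
    · rw [map_pow, hx1, one_pow]
    · rwa [he, ← map_pow]
  -- the ring `R = O[x]`
  let R := Algebra.adjoin O {x}
  have hOR : ∀ a ∈ O, a ∈ R := fun a ha => R.algebraMap_mem ⟨a, ha⟩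
  have hxR : x ∈ R := Algebra.self_mem_adjoin_singleton O x
  have hRV : ∀ f ∈ R, V.valuation f ≤ 1 := by
    intro f hf
    induction hf using Algebra.adjoin_induction with
    | mem y hy => rw [Set.mem_singleton_iff.1 hy]; exact hx1.le
    | algebraMap r => exact ((hO _).1 r.2).2
    | add y y' _ _ h h' => exact V.valuation.map_add_le h h'
    | mul y y' _ _ h h' => rw [map_mul]; exact mul_le_one' h h'
  have hexp : ∀ f ∈ R, ∃ a ∈ O, ∃ h ∈ R, f = a + (x - e) * h := by
    intro f hf
    induction hf using Algebra.adjoin_induction with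
    | mem y hy =>
      rw [Set.mem_singleton_iff.1 hy]
      exact ⟨e, hcO ξ, 1, one_mem _, by ring⟩
    | algebraMap r => exact ⟨r, r.2, 0, zero_mem _, by rw [mul_zero, add_zero]; rfl⟩
    | add y y' _ _ h h' =>
      obtain ⟨a, ha, g, hg, rfl⟩ := h
      obtain ⟨a', ha', g', hg', rfl⟩ := h'
      exact ⟨a + a', add_mem ha ha', g + g', add_mem hg hg', by ring⟩
    | mul y y' hy _ h h' =>
      obtain ⟨a, ha, g, hg, h1⟩ := h
      obtain ⟨a', ha', g', hg', rfl⟩ := h'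
      refine ⟨a * a', mul_mem ha ha', g * a' + y * g', add_mem (mul_mem hg (hOR _ ha'))
        (mul_mem hy hg'), ?_⟩
      rw [h1]
      ring
  -- The nonunit f is a + (x - e)h with a in zO. Multiplication by the unit M turns (x - e)h into z
  -- b h, hence f into a multiple of z in R without changing its value.
  have hstep : ∀ f ∈ R, V.valuation f < 1 → ∃ g ∈ R, V.valuation f = V.valuation (z * g) := by
    intro f hf hf1
    obtain ⟨a, ha, h, hh, rfl⟩ := hexp f hf
    have ha1 : V.valuation a < 1 := by
      have h2 : V.valuation ((x - e) * h) < 1 := by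
        rw [map_mul]
        exact (mul_le_of_le_one_right' (hRV h hh)).trans_lt hξ
      have := V.valuation.map_sub_lt hf1 h2
      rwa [add_sub_cancel_right] at this
    obtain ⟨a', ha', rfl⟩ := hdiv a ha ha1
    have hMR : M ∈ R := sum_mem fun i _ => mul_mem (pow_mem hxR _) (pow_mem (hOR _ (hcO ξ)) _)
    refine ⟨a' * M + b * h, add_mem (mul_mem (hOR _ ha') hMR) (mul_mem (hOR _ hb) hh), ?_⟩
    rw [← mul_one (V.valuation _), ← hVM, ← map_mul]
    congr 1
    linear_combination h * hMe + h * hbe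
  -- denominators
  have hden : ∀ f : K, ∃ n : ℕ, z ^ n * f ∈ R := by
    intro f
    have hint : IsIntegral K' x := by
      refine ⟨Polynomial.X ^ N - Polynomial.C ⟨x ^ N, hmem⟩,
        Polynomial.monic_X_pow_sub_C _ hNpos.ne', ?_⟩
      rw [← Polynomial.aeval_def]
      simp [IntermediateField.algebraMap_apply]
    have hf : f ∈ Algebra.adjoin K' {x} := by
      rw [← IntermediateField.adjoin_simple_toSubalgebra_of_isAlgebraic hint.isAlgebraic, htop]
      trivial
    have hzR : ∀ n : ℕ, z ^ n ∈ R := fun n => pow_mem (hOR z ((hO z).2 ⟨hzK', hz.le⟩)) n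
    induction hf using Algebra.adjoin_induction with
    | mem y hy => exact ⟨0, by rw [Set.mem_singleton_iff.1 hy, pow_zero, one_mul]; exact hxR⟩
    | algebraMap r =>
      change ∃ n : ℕ, z ^ n * (r : K) ∈ R
      by_cases hr0 : (r : K) = 0
      · exact ⟨0, by rw [hr0, mul_zero]; exact zero_mem _⟩
      obtain ⟨m, w, c, hc, h1, h2⟩ := exists_leading (hgen.ge r.2) hr0
      refine ⟨m.natAbs, hOR _ ((hO _).2 ⟨mul_mem (pow_mem hzK' _) r.2, ?_⟩)⟩
      rw [h1, map_mul, map_mul, map_zpow₀, map_pow,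
        valuation_eq_one_of_sub_algebraMap hV hc (h2 V hV hz), mul_one, ← zpow_natCast,
        ← zpow_add₀ hvz.ne']
      obtain ⟨l, hl⟩ := Int.eq_ofNat_of_zero_le (show 0 ≤ (m.natAbs : ℤ) + m by omega)
      rw [hl, zpow_natCast]
      exact pow_le_one₀ zero_le hz.le
    | add y y' _ _ h h' =>
      obtain ⟨n, hn⟩ := h
      obtain ⟨n', hn'⟩ := h'
      refine ⟨n + n', ?_⟩
      have := add_mem (mul_mem (hzR n') hn) (mul_mem (hzR n) hn')
      convert this using 1
      ring
    | mul y y' _ _ h h' =>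
      obtain ⟨n, hn⟩ := h
      obtain ⟨n', hn'⟩ := h'
      refine ⟨n + n', ?_⟩
      have := mul_mem hn hn'
      convert this using 1
      ring
  -- Factors z are removed from the denominator one at a time. Only values are tracked, since
  -- `hstep` replaces f by another element of the same value.
  have hmain : ∀ (n : ℕ) (f : K), V.valuation (z ^ n * f) ∈ V.valuation '' (R : Set K) →
      V.valuation f < 1 → V.valuation f ≤ V.valuation z := by
    intro n
    induction n with
    | zero =>
      rintro f ⟨g, hg, hgf⟩ hf
      rw [pow_zero, one_mul] at hgf
      obtain ⟨g', hg', h1⟩ := hstep g hg (by rwa [hgf])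
      rw [← hgf, h1, map_mul]
      exact mul_le_of_le_one_right' (hRV g' hg')
    | succ n ih =>
      rintro f ⟨g, hg, hgf⟩ hf
      obtain ⟨g', hg', h1⟩ := hstep g hg (by
        rw [hgf, map_mul]
        refine (mul_le_of_le_one_left' ?_).trans_lt hf
        rw [map_pow]
        exact pow_le_one₀ zero_le hz.le)
      refine ih f ⟨g', hg', ?_⟩ hf
      rw [h1, pow_succ', mul_assoc, map_mul, map_mul _ z] at hgf
      exact mul_left_cancel₀ hvz.ne' hgf
  refine ⟨hz0, hz, fun f hf => ?_⟩
  obtain ⟨n, hn⟩ := hden f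
  exact hmain n f ⟨_, hn, rfl⟩ hf

theorem isDifferentExponent_zero {K' : IntermediateField L K} {P : Place L K} {z : K}
    (hzK' : z ∈ K') (hz : IsUniformizer P.ring z) : IsDifferentExponent K' P 0 :=
  ⟨z, ⟨z, hzK'⟩, 1, hz, isUniformizer_comap_of_isUniformizer _ hz, by rw [one_smul], z, hz,
    by simp⟩

end Unramified

/-! ### The conic: parametrization and intersection with a fundamental line -/

section ConicVertex

variable {L K : Type*} [Field L] [Field K] [Algebra L K]

theorem transcendental_of_forall_ne [IsAlgClosed L] {s : K} (hs : ∀ c : L, s ≠ algebraMap L K c) :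
    Transcendental L s := by
  intro halg
  have hdeg := IsAlgClosed.degree_eq_one_of_irreducible L (minpoly.irreducible halg.isIntegral)
  obtain ⟨c, hc⟩ := minpoly.mem_range_of_degree_eq_one L s hdeg
  exact hs c hc.symm

/-- The function field `K = L(x, y)` of a curve whose image under
`Φ = (y / x ^ (r + 1), y ^ (r + 1) / x ^ r)` is a conic that does not pass through the vertices of
the fundamental triangle. -/
structure ConicVertex (K' : IntermediateField L K) (x y : K) (r : ℕ) (A₀ A₁ A₂ B₀ B₁ B₂ : L) :
    Prop where
  x_ne : x ≠ 0
  y_ne : y ≠ 0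
  gen : IntermediateField.adjoin L {y / x ^ (r + 1), y ^ (r + 1) / x ^ r} = K'
  top : IntermediateField.adjoin L {x, y} = ⊤
  A₀_ne : A₀ ≠ 0
  A₁_ne : A₁ ≠ 0
  A₂_ne : A₂ ≠ 0
  conic : algebraMap L K A₀ + algebraMap L K A₁ * (y / x ^ (r + 1)) ^ 2 +
    algebraMap L K A₂ * (y ^ (r + 1) / x ^ r) ^ 2 + algebraMap L K B₀ * (y / x ^ (r + 1)) +
    algebraMap L K B₁ * (y ^ (r + 1) / x ^ r) +
    algebraMap L K B₂ * (y / x ^ (r + 1)) * (y ^ (r + 1) / x ^ r) = 0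
  indep : ∀ a b c : L, algebraMap L K a + algebraMap L K b * (y / x ^ (r + 1)) +
    algebraMap L K c * (y ^ (r + 1) / x ^ r) = 0 → a = 0 ∧ b = 0 ∧ c = 0

namespace ConicVertex

variable {K' : IntermediateField L K} {x y : K} {r : ℕ} {A₀ A₁ A₂ B₀ B₁ B₂ : L}

/-- This identity makes K = K'(x) a radical extension of exponent r² + r + 1. -/
theorem pow_eq (h : ConicVertex K' x y r A₀ A₁ A₂ B₀ B₁ B₂) :
    x ^ ((r + 1) * r + 1) = (y ^ (r + 1) / x ^ r) / (y / x ^ (r + 1)) ^ (r + 1) := by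
  have hx := h.x_ne
  have hy := h.y_ne
  rw [div_pow, div_div_div_cancel_left' _ _ (pow_ne_zero _ hy), eq_div_iff (pow_ne_zero _ hx)]
  ring

theorem y_eq (h : ConicVertex K' x y r A₀ A₁ A₂ B₀ B₁ B₂) :
    y = y / x ^ (r + 1) * x ^ (r + 1) := by
  have hx := h.x_ne
  field_simp

theorem fst_mem (h : ConicVertex K' x y r A₀ A₁ A₂ B₀ B₁ B₂) : y / x ^ (r + 1) ∈ K' := by
  rw [← h.gen]
  exact IntermediateField.subset_adjoin _ _ (by simp)

theorem snd_mem (h : ConicVertex K' x y r A₀ A₁ A₂ B₀ B₁ B₂) : y ^ (r + 1) / x ^ r ∈ K' := by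
  rw [← h.gen]
  exact IntermediateField.subset_adjoin _ _ (by simp)

theorem pow_mem (h : ConicVertex K' x y r A₀ A₁ A₂ B₀ B₁ B₂) : x ^ ((r + 1) * r + 1) ∈ K' := by
  rw [h.pow_eq]
  exact div_mem h.snd_mem (_root_.pow_mem h.fst_mem _)

theorem adjoin_eq_top (h : ConicVertex K' x y r A₀ A₁ A₂ B₀ B₁ B₂) :
    IntermediateField.adjoin K' {x} = ⊤ := by
  have hx : x ∈ IntermediateField.adjoin K' {x} := IntermediateField.mem_adjoin_simple_self K' x
  have hle : IntermediateField.adjoin L {x, y} ≤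
      (IntermediateField.adjoin K' {x}).restrictScalars L := by
    rw [IntermediateField.adjoin_le_iff]
    rintro f (hf | hf)
    · exact hf ▸ hx
    · change f ∈ IntermediateField.adjoin K' {x}
      rw [Set.mem_singleton_iff.1 hf, h.y_eq]
      exact mul_mem ((IntermediateField.adjoin K' {x}).algebraMap_mem ⟨_, h.fst_mem⟩)
        (_root_.pow_mem hx _)
  rw [h.top] at hle
  exact top_unique fun f _ => hle (IntermediateField.mem_top (x := f))

theorem isAlgebraic (h : ConicVertex K' x y r A₀ A₁ A₂ B₀ B₁ B₂) : Algebra.IsAlgebraic K' K := by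
  have hint : IsIntegral K' x := by
    refine ⟨Polynomial.X ^ ((r + 1) * r + 1) - Polynomial.C ⟨_, h.pow_mem⟩,
      Polynomial.monic_X_pow_sub_C _ (by omega), ?_⟩
    rw [← Polynomial.aeval_def]
    simp [IntermediateField.algebraMap_apply]
  have := IntermediateField.isAlgebraic_adjoin_simple hint
  rw [h.adjoin_eq_top] at this
  exact ⟨fun f => by
    have := this.isAlgebraic (⟨f, trivial⟩ : (⊤ : IntermediateField K' K))
    exact this.algebraMap (A := K)⟩

/-- On the line η = 0 the conic misses the origin because A₀ ≠ 0, and the point at infinity because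
A₁ ≠ 0. So ξ has neither a zero nor a pole there. -/
theorem valuation_fst (h : ConicVertex K' x y r A₀ A₁ A₂ B₀ B₁ B₂) {V : ValuationSubring K}
    (hV : ∀ c : L, algebraMap L K c ∈ V) (hη : V.valuation (y ^ (r + 1) / x ^ r) < 1) :
    V.valuation (y / x ^ (r + 1)) = 1 := by
  have hc := h.conic
  set ξ := y / x ^ (r + 1)
  set η := y ^ (r + 1) / x ^ r
  have hle : ∀ c : L, V.valuation (algebraMap L K c) ≤ 1 := valuation_algebraMap_le_one hV
  have hη2 : V.valuation (η ^ 2) < 1 := by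
    rw [map_pow]
    exact pow_lt_one₀ zero_le hη two_ne_zero
  have hmul : ∀ (c : L) {f : K}, V.valuation f < 1 → V.valuation (algebraMap L K c * f) < 1 :=
    fun c f hf => by
      rw [map_mul]
      exact (mul_le_of_le_one_left' (hle c)).trans_lt hf
  rcases lt_trichotomy (V.valuation ξ) 1 with hlt | heq | hgt
  · exfalso
    have h1 : algebraMap L K A₀ = -(algebraMap L K A₁ * ξ ^ 2 + algebraMap L K A₂ * η ^ 2 +
        algebraMap L K B₀ * ξ + algebraMap L K B₁ * η + algebraMap L K B₂ * (ξ * η)) := by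
      linear_combination hc
    have h2 : V.valuation (algebraMap L K A₀) < 1 := by
      rw [h1, Valuation.map_neg]
      refine V.valuation.map_add_lt (V.valuation.map_add_lt (V.valuation.map_add_lt
        (V.valuation.map_add_lt (hmul _ ?_) (hmul _ hη2)) (hmul _ hlt)) (hmul _ hη)) (hmul _ ?_)
      · rw [map_pow]
        exact pow_lt_one₀ zero_le hlt two_ne_zero
      · rw [map_mul]
        exact (mul_le_of_le_one_left' hlt.le).trans_lt hη
    exact h2.ne (valuation_algebraMap_eq_one hV h.A₀_ne)
  · exact heq
  · exfalso
    have h1 : ξ * (algebraMap L K A₁ * ξ + (algebraMap L K B₀ + algebraMap L K B₂ * η)) =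
        -(algebraMap L K A₀ + algebraMap L K A₂ * η ^ 2 + algebraMap L K B₁ * η) := by
      linear_combination hc
    have h2 : V.valuation (algebraMap L K A₁ * ξ) = V.valuation ξ := by
      rw [map_mul, valuation_algebraMap_eq_one hV h.A₁_ne, one_mul]
    have h3 : V.valuation (algebraMap L K A₁ * ξ + (algebraMap L K B₀ + algebraMap L K B₂ * η)) =
        V.valuation ξ := by
      rw [← h2]
      refine V.valuation.map_add_eq_of_lt_left ?_
      rw [h2]
      exact (V.valuation.map_add_le (hle _) (hmul _ hη).le).trans_lt hgt
    have h4 := congrArg V.valuation h1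
    rw [map_mul, h3, Valuation.map_neg] at h4
    have h5 : V.valuation ξ * V.valuation ξ ≤ 1 := by
      rw [h4]
      exact V.valuation.map_add_le (V.valuation.map_add_le (hle _) (hmul _ hη2).le) (hmul _ hη).le
    exact absurd h5 (not_le.2 (one_lt_mul_of_lt_of_le' hgt hgt.le))

/-- Where ξ and η are units, so is x by `pow_eq`. A parameter of the rational field K' at the point
below then remains one in K. -/
theorem isDifferentExponent_zero [IsAlgClosed L] (h : ConicVertex K' x y r A₀ A₁ A₂ B₀ B₁ B₂)
    (hN : (((r + 1) * r + 1 : ℕ) : L) ≠ 0) {s : K} (hs : IntermediateField.adjoin L {s} = K')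
    {P : Place L K} (hξ : P.ring.valuation (y / x ^ (r + 1)) = 1)
    (hη : P.ring.valuation (y ^ (r + 1) / x ^ r) = 1) : IsDifferentExponent K' P 0 := by
  have halg := h.isAlgebraic
  rw [← hs] at halg
  obtain ⟨z, hz, hzs⟩ := P.exists_generator s
  rw [hs] at hzs
  have hz0 : z ≠ 0 := by
    rintro rfl
    obtain ⟨c, hc⟩ : y / x ^ (r + 1) ∈ (⊥ : IntermediateField L K) := by
      rw [← IntermediateField.adjoin_zero (F := L) (E := K), hzs]
      exact h.fst_mem
    have hc' : algebraMap L K c = y / x ^ (r + 1) := hc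
    have := (h.indep (-c) 1 0 (by rw [map_neg, hc', map_one, map_zero]; ring)).2.1
    exact one_ne_zero this
  have hx : P.ring.valuation x = 1 := by
    have h1 := congrArg P.ring.valuation h.pow_eq
    rw [map_div₀, map_pow, map_pow, hξ, hη, one_pow, div_one] at h1
    exact (pow_left_inj₀ zero_le zero_le (by omega)).1 (h1.trans (one_pow _).symm)
  exact _root_.isDifferentExponent_zero (hzs.le (IntermediateField.mem_adjoin_simple_self L z))
    (isUniformizer_of_pow_valuation_eq_one hzs hz0 hN h.pow_mem h.adjoin_eq_top
      P.algebraMap_mem hz hx)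

/-- Projection of the conic from the point `(ρ, 0)`. -/
theorem exists_param [IsAlgClosed L] (h : ConicVertex K' x y r A₀ A₁ A₂ B₀ B₁ B₂) :
    ∃ (ρ : L) (s : K), A₁ * ρ ^ 2 + B₀ * ρ + A₀ = 0 ∧ IntermediateField.adjoin L {s} = K' ∧
      (∀ c : L, s ≠ algebraMap L K c) ∧
      y / x ^ (r + 1) = algebraMap L K ρ + s * (y ^ (r + 1) / x ^ r) ∧
      (algebraMap L K A₁ * s ^ 2 + algebraMap L K B₂ * s + algebraMap L K A₂) *
          (y ^ (r + 1) / x ^ r) =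
        -(algebraMap L K (2 * A₁ * ρ + B₀) * s + algebraMap L K (B₁ + B₂ * ρ)) := by
  -- (ρ, 0) is a point of the conic on the line η = 0.
  obtain ⟨ρ, hρ⟩ : ∃ ρ : L, A₁ * ρ ^ 2 + B₀ * ρ + A₀ = 0 := by
    obtain ⟨ρ, hρ⟩ := IsAlgClosed.exists_root
      (Polynomial.C A₁ * Polynomial.X ^ 2 + Polynomial.C B₀ * Polynomial.X + Polynomial.C A₀)
      (by rw [Polynomial.degree_quadratic h.A₁_ne]; decide)
    exact ⟨ρ, by simpa using hρ⟩
  have hξK := h.fst_mem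
  have hηK := h.snd_mem
  have hgen := h.gen
  have hc := h.conic
  have hind := h.indep
  have hη0 : y ^ (r + 1) / x ^ r ≠ 0 := div_ne_zero (pow_ne_zero _ h.y_ne) (pow_ne_zero _ h.x_ne)
  set ξ := y / x ^ (r + 1)
  set η := y ^ (r + 1) / x ^ r
  set s := (ξ - algebraMap L K ρ) / η with hs
  have hξ : ξ = algebraMap L K ρ + s * η := by
    rw [hs]
    field_simp
    ring
  have hsc : ∀ c : L, s ≠ algebraMap L K c := by
    intro c hc
    rw [hc] at hξ
    have := (hind (-ρ) 1 (-c) (by rw [hξ, map_neg, map_neg, map_one]; ring)).2.1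
    exact one_ne_zero this
  -- After the substitution ξ = ρ + sη the constant term vanishes by the choice of ρ. Cancelling η
  -- leaves an equation linear in η, which expresses η rationally in s.
  have hE : (algebraMap L K A₁ * s ^ 2 + algebraMap L K B₂ * s + algebraMap L K A₂) * η =
      -(algebraMap L K (2 * A₁ * ρ + B₀) * s + algebraMap L K (B₁ + B₂ * ρ)) := by
    have hρ' := congrArg (algebraMap L K) hρ
    refine mul_right_cancel₀ hη0 ?_
    rw [hξ] at hc
    simp only [map_add, map_mul, map_pow, map_zero, map_ofNat] at hρ' ⊢
    linear_combination hc - hρ'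
  refine ⟨ρ, s, hρ, le_antisymm ?_ ?_, hsc, hξ, hE⟩
  · rw [IntermediateField.adjoin_simple_le_iff]
    exact div_mem (sub_mem hξK (K'.algebraMap_mem ρ)) hηK
  · have hsm : s ∈ IntermediateField.adjoin L {s} := IntermediateField.mem_adjoin_simple_self L s
    have hcm : ∀ c : L, algebraMap L K c ∈ IntermediateField.adjoin L {s} :=
      fun c => (IntermediateField.adjoin L {s}).algebraMap_mem c
    have hD : algebraMap L K A₁ * s ^ 2 + algebraMap L K B₂ * s + algebraMap L K A₂ ≠ 0 := by
      intro h0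
      refine transcendental_of_forall_ne hsc ⟨Polynomial.C A₁ * Polynomial.X ^ 2 +
        Polynomial.C B₂ * Polynomial.X + Polynomial.C A₂, fun h1 => ?_, by simpa using h0⟩
      have := Polynomial.natDegree_quadratic (b := B₂) (c := A₂) h.A₁_ne
      rw [h1] at this
      simp at this
    have hηm : η ∈ IntermediateField.adjoin L {s} := by
      rw [eq_div_of_mul_eq hD ((mul_comm _ _).trans hE)]
      exact div_mem (neg_mem (add_mem (mul_mem (hcm _) hsm) (hcm _)))
        (add_mem (add_mem (mul_mem (hcm _) (_root_.pow_mem hsm 2)) (mul_mem (hcm _) hsm)) (hcm _))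
    rw [← hgen, IntermediateField.adjoin_le_iff]
    rintro f (rfl | rfl)
    · change ξ ∈ IntermediateField.adjoin L {s}
      rw [hξ]
      exact add_mem (hcm _) (mul_mem hsm hηm)
    · exact hηm

/-- The points at which the conic meets a fundamental line: one or two local parameters `z`, at
which `η = y ^ (r + 1) / x ^ r` has order `2` or `1`, respectively. -/
theorem exists_points [IsAlgClosed L] (h : ConicVertex K' x y r A₀ A₁ A₂ B₀ B₁ B₂) :
    (B₀ ^ 2 - 4 * A₀ * A₁ ≠ 0 ∧ ∃ z₁ z₂ : K,
      (∀ z ∈ ({z₁, z₂} : Set K), (∀ c : L, z ≠ algebraMap L K c) ∧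
        IntermediateField.adjoin L {z} = K' ∧
        ∀ V : ValuationSubring K, (∀ c : L, algebraMap L K c ∈ V) → V.valuation z < 1 →
          V.valuation (y ^ (r + 1) / x ^ r) = V.valuation z ^ 1) ∧
      (∀ V : ValuationSubring K, (∀ c : L, algebraMap L K c ∈ V) →
        V.valuation (y ^ (r + 1) / x ^ r) < 1 → V.valuation z₁ < 1 ∨ V.valuation z₂ < 1) ∧
      ∀ V : ValuationSubring K, (∀ c : L, algebraMap L K c ∈ V) → V.valuation z₁ < 1 →
        ¬ V.valuation z₂ < 1) ∨
    (B₀ ^ 2 - 4 * A₀ * A₁ = 0 ∧ ∃ z : K, (∀ c : L, z ≠ algebraMap L K c) ∧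
        IntermediateField.adjoin L {z} = K' ∧
        (∀ V : ValuationSubring K, (∀ c : L, algebraMap L K c ∈ V) → V.valuation z < 1 →
          V.valuation (y ^ (r + 1) / x ^ r) = V.valuation z ^ 2) ∧
        ∀ V : ValuationSubring K, (∀ c : L, algebraMap L K c ∈ V) →
        V.valuation (y ^ (r + 1) / x ^ r) < 1 → V.valuation z < 1) := by
  obtain ⟨ρ, s, hρ, hgen, hsc, hξ, hE⟩ := h.exists_param
  have hind := h.indep
  set ξ := y / x ^ (r + 1)
  set η := y ^ (r + 1) / x ^ r
  set e₁ := 2 * A₁ * ρ + B₀ with he₁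
  set e₀ := B₁ + B₂ * ρ with he₀
  -- e₁ is the derivative at ρ of the quadratic that cuts out the points with η = 0, so it vanishes
  -- exactly at a double root.
  have hdisc : B₀ ^ 2 - 4 * A₀ * A₁ = e₁ ^ 2 := by
    linear_combination (-4 * A₁) * hρ
  have hs0 : s ≠ 0 := by simpa using hsc 0
  have hη0 : η ≠ 0 := div_ne_zero (pow_ne_zero _ h.y_ne) (pow_ne_zero _ h.x_ne)
  have hz₁c : ∀ c : L, s⁻¹ ≠ algebraMap L K c := fun c hc =>
    hsc c⁻¹ (by rw [map_inv₀, ← hc, inv_inv])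
  have hle : ∀ {V : ValuationSubring K}, (∀ c : L, algebraMap L K c ∈ V) → ∀ c : L,
      V.valuation (algebraMap L K c) ≤ 1 := fun hV => valuation_algebraMap_le_one hV
  have hunit : ∀ {V : ValuationSubring K}, (∀ c : L, algebraMap L K c ∈ V) → ∀ {a : L} {f z : K},
      a ≠ 0 → V.valuation z < 1 → V.valuation f ≤ 1 →
      V.valuation (algebraMap L K a + f * z) = 1 := by
    intro V hV a f z ha hz hf
    refine valuation_eq_one_of_sub_algebraMap hV ha ?_
    rw [add_sub_cancel_left, map_mul]
    exact (mul_le_of_le_one_left' hf).trans_lt hz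
  have hlin : ∀ {V : ValuationSubring K}, (∀ c : L, algebraMap L K c ∈ V) → ∀ {z : K} (a b : L),
      V.valuation z ≤ 1 → V.valuation (algebraMap L K a * z + algebraMap L K b) ≤ 1 := by
    intro V hV z a b hz
    refine V.valuation.map_add_le ?_ (hle hV b)
    rw [map_mul]
    exact mul_le_one' (hle hV a) hz
  -- The equation for η divided by s², to be read near s = ∞.
  have hinf : (algebraMap L K A₁ + (algebraMap L K A₂ * s⁻¹ + algebraMap L K B₂) * s⁻¹) * η =
      -(s⁻¹ * (algebraMap L K e₁ + algebraMap L K e₀ * s⁻¹)) := by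
    field_simp
    linear_combination hE
  have hfin : ∀ V : ValuationSubring K, (∀ c : L, algebraMap L K c ∈ V) → V.valuation η < 1 →
      ¬ V.valuation s⁻¹ < 1 → V.valuation s ≤ 1 ∧
        V.valuation (algebraMap L K e₁ * s + algebraMap L K e₀) < 1 := by
    intro V hV hη hs
    have hs1 : V.valuation s ≤ 1 := by
      rw [map_inv₀, not_lt] at hs
      exact (one_le_inv₀ (zero_lt_iff.2 (by simpa using hs0))).1 hs
    refine ⟨hs1, ?_⟩
    have h1 := congrArg V.valuation hE
    rw [Valuation.map_neg, map_mul] at h1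
    rw [← h1]
    refine (mul_le_of_le_one_left' ?_).trans_lt hη
    have : algebraMap L K A₁ * s ^ 2 + algebraMap L K B₂ * s + algebraMap L K A₂ =
        (algebraMap L K A₁ * s + algebraMap L K B₂) * s + algebraMap L K A₂ := by ring
    rw [this]
    refine V.valuation.map_add_le ?_ (hle hV _)
    rw [map_mul]
    exact mul_le_one' (hlin hV _ _ hs1) hs1
  by_cases he : e₁ = 0
  · right
    refine ⟨by rw [hdisc, he]; ring, s⁻¹, hz₁c, (adjoin_simple_inv s).trans hgen, ?_, ?_⟩
    all_goals
      -- Otherwise the quadratic in s multiplying η would vanish, although s is transcendental.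
      have he00 : e₀ ≠ 0 := by
        intro h0
        rw [he, h0, map_zero, zero_mul, add_zero, neg_zero] at hE
        rcases mul_eq_zero.1 hE with h1 | h1
        · refine transcendental_of_forall_ne hsc ⟨Polynomial.C A₁ * Polynomial.X ^ 2 +
            Polynomial.C B₂ * Polynomial.X + Polynomial.C A₂, fun h2 => ?_, by simpa using h1⟩
          have := Polynomial.natDegree_quadratic (b := B₂) (c := A₂) h.A₁_ne
          rw [h2] at this
          simp at this
        · exact hη0 h1
    · intro V hV hz
      have h1 := congrArg V.valuation hinf
      rw [map_mul, hunit hV h.A₁_ne hz (hlin hV _ _ hz.le), one_mul, he, map_zero, zero_add,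
        Valuation.map_neg, map_mul, map_mul, valuation_algebraMap_eq_one hV he00, one_mul] at h1
      rw [h1, sq]
    · intro V hV hη
      by_contra hcon
      have h1 := (hfin V hV hη hcon).2
      rw [he, map_zero, zero_mul, zero_add, valuation_algebraMap_eq_one hV he00] at h1
      exact lt_irrefl _ h1
  · left
    -- s = ∞ is the projecting line η = 0 itself, which leads to the other root; s = -e₀ / e₁ is the
    -- tangent at (ρ, 0), which leads back to ρ.
    refine ⟨by rw [hdisc]; exact pow_ne_zero 2 he, s⁻¹, s - algebraMap L K (-e₀ / e₁), ?_, ?_, ?_⟩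
    · rintro z (rfl | rfl)
      · refine ⟨hz₁c, (adjoin_simple_inv s).trans hgen, fun V hV hz => ?_⟩
        have h1 := congrArg V.valuation hinf
        rw [map_mul, hunit hV h.A₁_ne hz (hlin hV _ _ hz.le), one_mul,
          Valuation.map_neg, map_mul, hunit hV he hz (hle hV _), mul_one] at h1
        rw [h1, pow_one]
      · refine ⟨fun c hc => hsc (c + -e₀ / e₁) (by rw [map_add, ← hc]; ring),
          (adjoin_simple_sub_algebraMap s _).trans hgen, fun V hV hz => ?_⟩
        set c := -e₀ / e₁ with hc
        have hec : e₁ * c + e₀ = 0 := by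
          rw [hc]
          field_simp
          ring
        have hec' := congrArg (algebraMap L K) hec
        simp only [map_add, map_mul, map_zero] at hec'
        -- A common zero c of numerator and denominator would let s - c be cancelled, leaving a
        -- linear relation between 1, ξ and η.
        have hDc : A₁ * c ^ 2 + B₂ * c + A₂ ≠ 0 := by
          intro h0
          have h0' := congrArg (algebraMap L K) h0
          simp only [map_add, map_mul, map_pow, map_zero] at h0'
          have h1 : (s - algebraMap L K c) * ((algebraMap L K A₁ * (s + algebraMap L K c) +
              algebraMap L K B₂) * η + algebraMap L K e₁) = 0 := by
            linear_combination hE - η * h0' - hec'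
          rcases mul_eq_zero.1 h1 with h2 | h2
          · exact hsc c (sub_eq_zero.1 h2)
          · refine h.A₁_ne (hind (e₁ - A₁ * ρ) A₁ (A₁ * c + B₂) ?_).2.1
            rw [hξ]
            simp only [map_add, map_sub, map_mul]
            linear_combination h2
        have h1 : (algebraMap L K (A₁ * c ^ 2 + B₂ * c + A₂) +
            (algebraMap L K A₁ * (s - algebraMap L K c) + algebraMap L K (2 * A₁ * c + B₂)) *
              (s - algebraMap L K c)) * η = -(algebraMap L K e₁ * (s - algebraMap L K c)) := by
          simp only [map_add, map_mul, map_pow, map_ofNat]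
          linear_combination hE - hec'
        have h1 := congrArg V.valuation h1
        rw [map_mul, hunit hV hDc hz (hlin hV _ _ hz.le), one_mul, Valuation.map_neg, map_mul,
          valuation_algebraMap_eq_one hV he, one_mul] at h1
        rw [h1, pow_one]
    · intro V hV hη
      refine or_iff_not_imp_left.2 fun hcon => ?_
      have h1 := (hfin V hV hη hcon).2
      have h2 : s - algebraMap L K (-e₀ / e₁) =
          algebraMap L K e₁⁻¹ * (algebraMap L K e₁ * s + algebraMap L K e₀) := by
        have : algebraMap L K e₁ ≠ 0 := by simpa using he
        rw [map_div₀, map_neg, map_inv₀]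
        field_simp
        ring
      rw [h2, map_mul, valuation_algebraMap_eq_one hV (inv_ne_zero he), one_mul]
      exact h1
    · intro V hV hz hz'
      have h1 : V.valuation s ≤ 1 := by
        have := V.valuation.map_add_le hz'.le (hle hV (-e₀ / e₁))
        rwa [sub_add_cancel] at this
      rw [map_inv₀, inv_lt_one₀ (zero_lt_iff.2 (by simpa using hs0))] at hz
      exact absurd hz (not_lt.2 h1)

end ConicVertex

end ConicVertex

/-! ### Ramified places, cyclic symmetry and the order of the different -/

section CyclicConic

variable {L K : Type*} [Field L] [Field K] [Algebra L K]

namespace ConicVertex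

variable {K' : IntermediateField L K} {x y : K} {r : ℕ} {A₀ A₁ A₂ B₀ B₁ B₂ : L}

/-- Over a point with η = 0 the function ξ is a unit, so x^N = η / ξ^(r+1) has the value of η. -/
theorem totallyRamified (h : ConicVertex K' x y r A₀ A₁ A₂ B₀ B₁ B₂) {z : K} {ε : ℕ} {α β : ℤ}
    (hε : ε ≠ 0) (hz : ∀ c : L, z ≠ algebraMap L K c)
    (hgen : IntermediateField.adjoin L {z} = K')
    (hbez : α * ε + β * (((r + 1) * r + 1 : ℕ) : ℤ) = 1)
    (hval : ∀ V : ValuationSubring K, (∀ c : L, algebraMap L K c ∈ V) → V.valuation z < 1 →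
      V.valuation (y ^ (r + 1) / x ^ r) = V.valuation z ^ ε) :
    TotallyRamified K' z x ((r + 1) * r + 1) ε α β where
  gen := hgen
  z_ne := by simpa using hz 0
  x_ne := h.x_ne
  pos := by omega
  mem := h.pow_mem
  top := h.adjoin_eq_top
  bezout := hbez
  val V hV hz1 := by
    have hη := hval V hV hz1
    have hlt : V.valuation (y ^ (r + 1) / x ^ r) < 1 := by
      rw [hη]
      exact pow_lt_one₀ zero_le hz1 hε
    rw [← map_pow, h.pow_eq, map_div₀, map_pow _ (y / x ^ (r + 1)), h.valuation_fst hV hlt, hη,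
      one_pow, div_one, zpow_natCast]

/-- The places over the points at which the conic meets a fundamental line. -/
theorem exists_places [IsAlgClosed L] (h : ConicVertex K' x y r A₀ A₁ A₂ B₀ B₁ B₂)
    (hN : (((r + 1) * r + 1 : ℕ) : L) ≠ 0) :
    Module.finrank K' K = (r + 1) * r + 1 ∧ ∃ (ε : ℕ) (S : Finset (Place L K)),
      (B₀ ^ 2 - 4 * A₀ * A₁ ≠ 0 ∧ S.card = 2 ∧ ε = 1 ∨
        B₀ ^ 2 - 4 * A₀ * A₁ = 0 ∧ S.card = 1 ∧ ε = 2) ∧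
      (∀ P, P ∈ S ↔ P.ring.valuation (y ^ (r + 1) / x ^ r) < 1) ∧
      ∀ P ∈ S, HasOrder P.ring x ε ∧ HasOrder P.ring y (ε * (r + 1)) ∧
        IsDifferentExponent K' P ((((r + 1) * r + 1 : ℕ) : ℤ) - 1) := by
  classical
  have horder : ∀ {P : Place L K} {ε : ℕ}, P.ring.valuation (y ^ (r + 1) / x ^ r) < 1 →
      HasOrder P.ring x ε → HasOrder P.ring y (ε * (r + 1)) := by
    rintro P ε hP ⟨π, hπ, hx⟩
    refine ⟨π, hπ, ?_⟩
    rw [h.y_eq, map_mul, h.valuation_fst P.algebraMap_mem hP, one_mul, map_pow, hx,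
      zpow_mul, ← zpow_natCast]
    norm_cast
  rcases h.exists_points with ⟨hd, z₁, z₂, hz, hcov, hdisj⟩ | ⟨hd, z, hzc, hgen, hval, hcov⟩
  · obtain ⟨hc₁, hg₁, hv₁⟩ := hz z₁ (by simp)
    obtain ⟨hc₂, hg₂, hv₂⟩ := hz z₂ (by simp)
    have h₁ := h.totallyRamified (α := 1) (β := 0) one_ne_zero hc₁ hg₁ (by simp) hv₁
    have h₂ := h.totallyRamified (α := 1) (β := 0) one_ne_zero hc₂ hg₂ (by simp) hv₂
    obtain ⟨P₁, hP₁⟩ := Place.exists_of_transcendental (transcendental_of_forall_ne hc₁)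
    obtain ⟨P₂, hP₂⟩ := Place.exists_of_transcendental (transcendental_of_forall_ne hc₂)
    have hne : P₁ ≠ P₂ := by
      rintro rfl
      exact hdisj _ P₁.algebraMap_mem hP₁ hP₂
    have hmem : ∀ P : Place L K, P ∈ ({P₁, P₂} : Finset (Place L K)) ↔
        P.ring.valuation (y ^ (r + 1) / x ^ r) < 1 := by
      intro P
      rw [Finset.mem_insert, Finset.mem_singleton]
      constructor
      · rintro (rfl | rfl)
        · rwa [hv₁ _ P.algebraMap_mem hP₁, pow_one]
        · rwa [hv₂ _ P.algebraMap_mem hP₂, pow_one]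
      · intro hP
        rcases hcov _ P.algebraMap_mem hP with h' | h'
        · exact Or.inl (h₁.place_unique h' hP₁)
        · exact Or.inr (h₂.place_unique h' hP₂)
    refine ⟨h₁.finrank_eq hP₁, 1, {P₁, P₂}, Or.inl ⟨hd, Finset.card_pair hne, rfl⟩, hmem,
      fun P hP => ?_⟩
    have hη := (hmem P).1 hP
    rw [Finset.mem_insert, Finset.mem_singleton] at hP
    rcases hP with rfl | rfl
    · exact ⟨h₁.hasOrder hP₁, horder hη (h₁.hasOrder hP₁), h₁.isDifferentExponent hN hP₁⟩
    · exact ⟨h₂.hasOrder hP₂, horder hη (h₂.hasOrder hP₂), h₂.isDifferentExponent hN hP₂⟩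
  -- N is odd since r(r + 1) is even. With N = 2m + 1 the Bézout relation for the order 2 is -m · 2
  -- + 1 · N = 1.
  · obtain ⟨m, hm⟩ : ∃ m : ℕ, (r + 1) * r + 1 = 2 * m + 1 := by
      obtain ⟨m, hm⟩ := Nat.even_mul_succ_self r
      exact ⟨m, by rw [mul_comm, hm]; omega⟩
    have h₁ := h.totallyRamified (α := -m) (β := 1) two_ne_zero hzc hgen
      (by rw [hm]; push_cast; ring) hval
    obtain ⟨P₁, hP₁⟩ := Place.exists_of_transcendental (transcendental_of_forall_ne hzc)
    have hmem : ∀ P : Place L K, P ∈ ({P₁} : Finset (Place L K)) ↔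
        P.ring.valuation (y ^ (r + 1) / x ^ r) < 1 := by
      intro P
      rw [Finset.mem_singleton]
      constructor
      · rintro rfl
        rw [hval _ P.algebraMap_mem hP₁]
        exact pow_lt_one₀ zero_le hP₁ two_ne_zero
      · exact fun hP => h₁.place_unique (hcov _ P.algebraMap_mem hP) hP₁
    refine ⟨h₁.finrank_eq hP₁, 2, {P₁}, Or.inr ⟨hd, Finset.card_singleton _, rfl⟩, hmem,
      fun P hP => ?_⟩
    have hη := (hmem P).1 hP
    rw [Finset.mem_singleton] at hP
    subst hP
    exact ⟨h₁.hasOrder hP₁, horder hη (h₁.hasOrder hP₁), h₁.isDifferentExponent hN hP₁⟩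

/-- With `rotate_snd`: turning to the next vertex replaces (ξ, η) by (1/η, ξ/η), that is, (1 : ξ :
η) by (η : 1 : ξ). -/
theorem rotate_fst (h : ConicVertex K' x y r A₀ A₁ A₂ B₀ B₁ B₂) :
    x⁻¹ / (y / x) ^ (r + 1) = (y ^ (r + 1) / x ^ r)⁻¹ := by
  have hx := h.x_ne
  have hy := h.y_ne
  rw [inv_div, div_pow, div_eq_div_iff (div_ne_zero (pow_ne_zero _ hy) (pow_ne_zero _ hx))
    (pow_ne_zero _ hy)]
  field_simp
  ring

theorem rotate_snd (h : ConicVertex K' x y r A₀ A₁ A₂ B₀ B₁ B₂) :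
    x⁻¹ ^ (r + 1) / (y / x) ^ r = (y / x ^ (r + 1)) / (y ^ (r + 1) / x ^ r) := by
  have hx := h.x_ne
  have hy := h.y_ne
  rw [div_pow, inv_pow]
  field_simp
  ring

/-- The conic looks the same from all three vertices if it is preserved by the cyclic permutation
of the coordinates. -/
theorem rotate (h : ConicVertex K' x y r A₀ A₁ A₂ B₀ B₁ B₂) {c : L}
    (hA₀ : A₂ = c * A₀) (hA₁ : A₀ = c * A₁) (hA₂ : A₁ = c * A₂)
    (hB₀ : B₁ = c * B₀) (hB₁ : B₂ = c * B₁) (hB₂ : B₀ = c * B₂) :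
    ConicVertex K' (y / x) x⁻¹ r A₀ A₁ A₂ B₀ B₁ B₂ where
  x_ne := div_ne_zero h.y_ne h.x_ne
  y_ne := inv_ne_zero h.x_ne
  gen := by
    rw [h.rotate_fst, h.rotate_snd]
    refine le_antisymm ?_ ?_
    · rw [IntermediateField.adjoin_le_iff]
      rintro f (hf | hf)
      · rw [hf]
        exact inv_mem h.snd_mem
      · rw [Set.mem_singleton_iff.1 hf]
        exact div_mem h.fst_mem h.snd_mem
    · have hη0 : y ^ (r + 1) / x ^ r ≠ 0 :=
        div_ne_zero (pow_ne_zero _ h.y_ne) (pow_ne_zero _ h.x_ne)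
      rw [← h.gen]
      set ξ := y / x ^ (r + 1)
      set η := y ^ (r + 1) / x ^ r
      have h1 : η ∈ IntermediateField.adjoin L {η⁻¹, ξ / η} := by
        have := inv_mem (IntermediateField.subset_adjoin L {η⁻¹, ξ / η} (Set.mem_insert _ _))
        rwa [inv_inv] at this
      rw [IntermediateField.adjoin_le_iff]
      rintro f (hf | hf)
      · rw [hf]
        have := mul_mem (IntermediateField.subset_adjoin L {η⁻¹, ξ / η}
          (Set.mem_insert_of_mem _ rfl)) h1
        rwa [div_mul_cancel₀ _ hη0] at this
      · rw [Set.mem_singleton_iff.1 hf]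
        exact h1
  top := by
    rw [← top_le_iff, ← h.top, IntermediateField.adjoin_le_iff]
    have h1 : x ∈ IntermediateField.adjoin L {y / x, x⁻¹} := by
      have := inv_mem (IntermediateField.subset_adjoin L {y / x, x⁻¹}
        (Set.mem_insert_of_mem _ rfl))
      rwa [inv_inv] at this
    rintro f (hf | hf)
    · rw [hf]
      exact h1
    · rw [Set.mem_singleton_iff.1 hf]
      have := mul_mem (IntermediateField.subset_adjoin L {y / x, x⁻¹} (Set.mem_insert _ _)) h1
      rwa [div_mul_cancel₀ _ h.x_ne] at this
  A₀_ne := h.A₀_ne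
  A₁_ne := h.A₁_ne
  A₂_ne := h.A₂_ne
  conic := by
    have hη0 : y ^ (r + 1) / x ^ r ≠ 0 :=
      div_ne_zero (pow_ne_zero _ h.y_ne) (pow_ne_zero _ h.x_ne)
    have hc := h.conic
    rw [h.rotate_fst, h.rotate_snd]
    set ξ := y / x ^ (r + 1)
    set η := y ^ (r + 1) / x ^ r
    have e0 := congrArg (algebraMap L K) hA₀
    have e1 := congrArg (algebraMap L K) hA₁
    have e2 := congrArg (algebraMap L K) hA₂
    have f0 := congrArg (algebraMap L K) hB₀
    have f1 := congrArg (algebraMap L K) hB₁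
    have f2 := congrArg (algebraMap L K) hB₂
    simp only [map_mul] at e0 e1 e2 f0 f1 f2
    -- This is the conic with cyclically permuted coefficients; the hypotheses say that c times it
    -- is the original equation.
    have key : algebraMap L K A₀ * η ^ 2 + algebraMap L K A₁ + algebraMap L K A₂ * ξ ^ 2 +
        algebraMap L K B₀ * η + algebraMap L K B₁ * (ξ * η) + algebraMap L K B₂ * ξ = 0 := by
      have hc0 : algebraMap L K c ≠ 0 := by
        intro h0
        rw [h0, zero_mul] at e0
        exact h.A₂_ne (by simpa using e0)
      refine mul_left_cancel₀ hc0 ?_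
      linear_combination hc - η ^ 2 * e0 - e1 - ξ ^ 2 * e2 - η * f0 - ξ * η * f1 - ξ * f2
    field_simp
    linear_combination key
  indep a b d hz := by
    have hη0 : y ^ (r + 1) / x ^ r ≠ 0 :=
      div_ne_zero (pow_ne_zero _ h.y_ne) (pow_ne_zero _ h.x_ne)
    rw [h.rotate_fst, h.rotate_snd] at hz
    have hi := h.indep b d a
    set ξ := y / x ^ (r + 1)
    set η := y ^ (r + 1) / x ^ r
    obtain ⟨h1, h2, h3⟩ := hi (by
      field_simp at hz
      linear_combination hz)
    exact ⟨h3, h1, h2⟩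

end ConicVertex

/-- The places at which the conic passes through a fundamental line are exactly the places at which
`Φ` is ramified; the different is computed from them. -/
theorem exists_isDifferent_of_conicVertex [IsAlgClosed L] {K' : IntermediateField L K}
    {x y : Fin 3 → K} {r : ℕ} {A₀ A₁ A₂ B₀ B₁ B₂ c : L}
    (hN : (((r + 1) * r + 1 : ℕ) : L) ≠ 0) (hr : 1 ≤ r)
    (h : ConicVertex K' (x 2) (y 2) r A₀ A₁ A₂ B₀ B₁ B₂)
    (hx : ∀ i, x (i + 1) = y i / x i) (hy : ∀ i, y (i + 1) = (x i)⁻¹)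
    (hA₀ : A₂ = c * A₀) (hA₁ : A₀ = c * A₁) (hA₂ : A₁ = c * A₂)
    (hB₀ : B₁ = c * B₀) (hB₁ : B₂ = c * B₁) (hB₂ : B₀ = c * B₂) :
    Module.finrank K' K = (r + 1) * r + 1 ∧ ∃ D : Place L K →₀ ℤ, IsDifferent K' D ∧
      (B₀ ^ 2 - 4 * A₀ * A₁ ≠ 0 → divisorOrder D = 6 * ((((r + 1) * r + 1 : ℕ) : ℤ) - 1)) ∧
      (B₀ ^ 2 - 4 * A₀ * A₁ = 0 → divisorOrder D = 3 * ((((r + 1) * r + 1 : ℕ) : ℤ) - 1)) ∧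
      (B₀ ^ 2 - 4 * A₀ * A₁ ≠ 0 → ∀ i, ∃ P₁ P₂ : Place L K, P₁ ≠ P₂ ∧ ∀ P ∈ ({P₁, P₂} : Set (Place L K)),
        HasOrder P.ring (x i) 1 ∧ HasOrder P.ring (y i) (r + 1)) ∧
      (B₀ ^ 2 - 4 * A₀ * A₁ = 0 → ∀ P : Place L K, ∀ m l : ℤ, HasOrder P.ring (x 2) m → HasOrder P.ring (y 2) l →
        min m l = 1 → l = r + 1 → False) := by
  classical
  have hv : ∀ i, ConicVertex K' (x i) (y i) r A₀ A₁ A₂ B₀ B₁ B₂ := by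
    have hstep : ∀ i, ConicVertex K' (x i) (y i) r A₀ A₁ A₂ B₀ B₁ B₂ →
        ConicVertex K' (x (i + 1)) (y (i + 1)) r A₀ A₁ A₂ B₀ B₁ B₂ := fun i hi => by
      rw [hx, hy]
      exact hi.rotate hA₀ hA₁ hA₂ hB₀ hB₁ hB₂
    have h0 := hstep 2 h
    have h1 := hstep _ h0
    intro i
    fin_cases i
    exacts [h0, h1, h]
  choose hfin ε S hcard hmem hS using fun i => (hv i).exists_places hN
  set M : ℤ := (((r + 1) * r + 1 : ℕ) : ℤ) - 1
  set ξ := y 2 / x 2 ^ (r + 1) with hξ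
  set η := y 2 ^ (r + 1) / x 2 ^ r with hη
  have hξ0 : ξ ≠ 0 := div_ne_zero h.y_ne (pow_ne_zero _ h.x_ne)
  have hη0 : η ≠ 0 := div_ne_zero (pow_ne_zero _ h.y_ne) (pow_ne_zero _ h.x_ne)
  have hx0 : x 0 = y 2 / x 2 := hx 2
  have hy0 : y 0 = (x 2)⁻¹ := hy 2
  have hx1 : x 1 = y 0 / x 0 := hx 0
  have hy1 : y 1 = (x 0)⁻¹ := hy 0
  have hη_0 : y 0 ^ (r + 1) / x 0 ^ r = ξ / η := by
    rw [hx0, hy0]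
    exact h.rotate_snd
  have hη_1 : y 1 ^ (r + 1) / x 1 ^ r = ξ⁻¹ := by
    rw [hx1, hy1, (hv 0).rotate_snd, hη_0, hx0, hy0, h.rotate_fst, ← hη]
    field_simp
  -- In the homogeneous coordinates (1 : ξ : η), the sets S 2, S 0 and S 1 lie over the zeros of the
  -- third, the second and the first coordinate. They are disjoint because the conic misses the
  -- vertices.
  have hS2 : ∀ P, P ∈ S 2 ↔ P.ring.valuation η < 1 := hmem 2
  have hS0 : ∀ P, P ∈ S 0 ↔ P.ring.valuation ξ < P.ring.valuation η := fun P => by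
    rw [hmem 0, hη_0, map_div₀, div_lt_one₀ (zero_lt_iff.2 (by simpa using hη0))]
  have hS1 : ∀ P, P ∈ S 1 ↔ 1 < P.ring.valuation ξ := fun P => by
    rw [hmem 1, hη_1, map_inv₀, inv_lt_one₀ (zero_lt_iff.2 (by simpa using hξ0))]
  have hS2' : ∀ P ∈ S 2, P.ring.valuation ξ = 1 := fun P hP =>
    h.valuation_fst P.algebraMap_mem ((hS2 P).1 hP)
  have hS0' : ∀ P ∈ S 0, P.ring.valuation η = 1 := fun P hP => by
    have := (hv 0).valuation_fst P.algebraMap_mem ((hmem 0 P).1 hP)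
    rwa [hx0, hy0, h.rotate_fst, map_inv₀, inv_eq_one] at this
  have hd02 : Disjoint (S 0) (S 2) := Finset.disjoint_left.2 fun P h0 h2 =>
    ((hS2 P).1 h2).ne (hS0' P h0)
  have hd01 : Disjoint (S 0) (S 1) := Finset.disjoint_left.2 fun P h0 h1 => by
    have h2 := (hS0 P).1 h0
    rw [hS0' P h0] at h2
    exact lt_asymm h2 ((hS1 P).1 h1)
  have hd12 : Disjoint (S 1) (S 2) := Finset.disjoint_left.2 fun P h1 h2 =>
    ((hS1 P).1 h1).ne' (hS2' P h2)
  set T := S 0 ∪ S 1 ∪ S 2 with hT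
  have hTcard : T.card = (S 0).card + (S 1).card + (S 2).card := by
    rw [hT, Finset.card_union_of_disjoint (Finset.disjoint_union_left.2 ⟨hd02, hd12⟩),
      Finset.card_union_of_disjoint hd01]
  let D : Place L K →₀ ℤ := Finsupp.indicator T fun _ _ => M
  have hDorder : divisorOrder D = T.card * M := by
    rw [divisorOrder, Finsupp.sum_of_support_subset D (s := T) (Finsupp.support_indicator_subset _ _)
      _ (fun _ _ => rfl), Finset.sum_congr rfl fun P hP => Finsupp.indicator_of_mem hP _,
      Finset.sum_const, nsmul_eq_mul]
  refine ⟨hfin 0, D, fun P => ?_, fun hd => ?_, fun hd => ?_,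
    fun hd i => ?_, fun hd P m l hm hl hml hlr => ?_⟩
  · by_cases hP : P ∈ T
    · rw [Finsupp.indicator_of_mem hP]
      rw [hT, Finset.mem_union, Finset.mem_union] at hP
      rcases hP with (hP | hP) | hP <;> exact (hS _ P hP).2.2
    · rw [Finsupp.indicator_of_notMem hP]
      rw [hT, Finset.mem_union, Finset.mem_union, hS0, hS1, hS2] at hP
      push Not at hP
      obtain ⟨⟨h1, h2⟩, h3⟩ := hP
      -- Off the three lines, v(ξ) ≤ 1 ≤ v(η) ≤ v(ξ), so all are equal.
      have hξ1 : P.ring.valuation ξ = 1 := le_antisymm h2 (h3.trans h1)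
      have hη1 : P.ring.valuation η = 1 := le_antisymm (h1.trans h2) h3
      obtain ⟨_, s, _, hs, _⟩ := h.exists_param
      exact h.isDifferentExponent_zero hN hs hξ1 hη1
  · have hc : ∀ i, (S i).card = 2 := fun i => by
      rcases hcard i with h' | h'
      · exact h'.2.1
      · exact absurd h'.1 hd
    rw [hDorder, hTcard, hc, hc, hc]
    norm_num
  · have hc : ∀ i, (S i).card = 1 := fun i => by
      rcases hcard i with h' | h'
      · exact absurd hd h'.1
      · exact h'.2.1
    rw [hDorder, hTcard, hc, hc, hc]
    norm_num
  · obtain ⟨h2, h1⟩ : (S i).card = 2 ∧ ε i = 1 := by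
      rcases hcard i with h' | h'
      · exact h'.2
      · exact absurd h'.1 hd
    obtain ⟨P₁, P₂, hne, hSi⟩ := Finset.card_eq_two.1 h2
    refine ⟨P₁, P₂, hne, fun P hP => ?_⟩
    have hP' : P ∈ S i := by
      rw [hSi]
      simpa using hP
    have := hS i P hP'
    rw [h1] at this
    exact ⟨by simpa using this.1, by simpa using this.2.1⟩
  · obtain ⟨_, h1⟩ : (S 2).card = 1 ∧ ε 2 = 2 := by
      rcases hcard 2 with h' | h'
      · exact absurd hd h'.1
      · exact h'.2
    -- As l = r + 1 ≥ 2, the minimum is attained by m. Then η has order (r + 1)² - r > 0, so P lies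
    -- in S 2, where x has order 2 in the tangent case.
    have hm1 : m = 1 := by
      rw [hlr] at hml
      omega
    have hη1 : P.ring.valuation η < 1 := by
      obtain ⟨π, hπ, hxπ⟩ := hm
      obtain ⟨ρ, hρ, hyρ⟩ := hl
      rw [hm1, zpow_one] at hxπ
      rw [hlr, ← hπ.valuation_eq hρ] at hyρ
      have hπ0 : P.ring.valuation π ≠ 0 := by simpa using hπ.1
      have h4 : P.ring.valuation (y 2) = P.ring.valuation π ^ (r + 1) := by
        rw [hyρ]
        norm_cast
      rw [hη, map_div₀, map_pow, map_pow, hxπ, h4,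
        div_lt_one₀ (zero_lt_iff.2 (pow_ne_zero _ hπ0)), ← pow_mul]
      exact pow_lt_pow_right_of_lt_one₀ (zero_lt_iff.2 hπ0) hπ.2.1 (by nlinarith)
    have := (hS 2 P ((hS2 P).2 hη1)).1.unique hm
    rw [h1, hm1] at this
    norm_num at this

end CyclicConic

/-! ### Pullbacks of lines and conics as explicit forms -/

section ConicForm

variable {L : Type*} [Field L]

/-- The exponent of the monomial `x₁ ^ i * x₂ ^ j * x₃ ^ l`. -/
noncomputable def expo (i j l : ℕ) : Fin 3 →₀ ℕ := Finsupp.equivFunOnFinite.symm ![i, j, l]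

theorem expo_inj {i j l i' j' l' : ℕ} : expo i j l = expo i' j' l' ↔ i = i' ∧ j = j' ∧ l = l' := by
  simp [expo, funext_iff, Fin.forall_fin_succ]

theorem eq_expo (d : Fin 3 →₀ ℕ) : d = expo (d 0) (d 1) (d 2) := by
  ext i
  fin_cases i <;> simp [expo]

theorem monomial_expo (i j l : ℕ) (c : L) :
    monomial (expo i j l) c = C c * X 0 ^ i * X 1 ^ j * X 2 ^ l := by
  rw [monomial_eq, Finsupp.prod_fintype _ _ (by simp), Fin.prod_univ_three]
  simp [expo, mul_assoc]

/-- The pullback of a line under `Φ`, as a form of degree `r + 2`. -/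
noncomputable def lineForm (r : ℕ) (a b c : L) : MvPolynomial (Fin 3) L :=
  monomial (expo (r + 1) 0 1) a + monomial (expo 0 1 (r + 1)) b + monomial (expo 1 (r + 1) 0) c

/-- The pullback of a conic under `Φ`, as a form of degree `2 * (r + 2)`. -/
noncomputable def conicForm (r : ℕ) (A₀ A₁ A₂ B₀ B₁ B₂ : L) : MvPolynomial (Fin 3) L :=
  monomial (expo (2 * r + 2) 0 2) A₀ + monomial (expo 0 2 (2 * r + 2)) A₁ +
    monomial (expo 2 (2 * r + 2) 0) A₂ + monomial (expo (r + 1) 1 (r + 2)) B₀ +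
    monomial (expo (r + 2) (r + 1) 1) B₁ + monomial (expo 1 (r + 2) (r + 1)) B₂

theorem isHomogeneous_monomial_expo {i j l n : ℕ} (c : L) (h : i + j + l = n) :
    (monomial (expo i j l) c).IsHomogeneous n := by
  refine isHomogeneous_monomial c ?_
  rw [Finsupp.degree_eq_sum, Fin.sum_univ_three]
  simpa [expo] using h

theorem lineForm_isHomogeneous (r : ℕ) (a b c : L) : (lineForm r a b c).IsHomogeneous (r + 2) :=
  ((isHomogeneous_monomial_expo _ (by omega)).add (isHomogeneous_monomial_expo _ (by omega))).add
    (isHomogeneous_monomial_expo _ (by omega))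

theorem conicForm_isHomogeneous (r : ℕ) (A₀ A₁ A₂ B₀ B₁ B₂ : L) :
    (conicForm r A₀ A₁ A₂ B₀ B₁ B₂).IsHomogeneous (2 * (r + 2)) :=
  (((((isHomogeneous_monomial_expo _ (by omega)).add (isHomogeneous_monomial_expo _ (by omega))).add
    (isHomogeneous_monomial_expo _ (by omega))).add (isHomogeneous_monomial_expo _ (by omega))).add
    (isHomogeneous_monomial_expo _ (by omega))).add (isHomogeneous_monomial_expo _ (by omega))

theorem eq_zero_of_lineForm_eq_zero {r : ℕ} {a b c : L} (h : lineForm r a b c = 0) :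
    a = 0 ∧ b = 0 ∧ c = 0 := by
  classical
  have h1 := congrArg (coeff (expo (r + 1) 0 1)) h
  have h2 := congrArg (coeff (expo 0 1 (r + 1))) h
  have h3 := congrArg (coeff (expo 1 (r + 1) 0)) h
  simp (disch := omega) only [lineForm, coeff_add, coeff_monomial, expo_inj, if_neg,
    coeff_zero, add_zero, zero_add] at h1 h2 h3
  exact ⟨h1, h2, h3⟩

theorem conicForm_inj {r : ℕ} {A₀ A₁ A₂ B₀ B₁ B₂ A₀' A₁' A₂' B₀' B₁' B₂' : L}
    (h : conicForm r A₀ A₁ A₂ B₀ B₁ B₂ = conicForm r A₀' A₁' A₂' B₀' B₁' B₂') :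
    A₀ = A₀' ∧ A₁ = A₁' ∧ A₂ = A₂' ∧ B₀ = B₀' ∧ B₁ = B₁' ∧ B₂ = B₂' := by
  classical
  have h1 := congrArg (coeff (expo (2 * r + 2) 0 2)) h
  have h2 := congrArg (coeff (expo 0 2 (2 * r + 2))) h
  have h3 := congrArg (coeff (expo 2 (2 * r + 2) 0)) h
  have h4 := congrArg (coeff (expo (r + 1) 1 (r + 2))) h
  have h5 := congrArg (coeff (expo (r + 2) (r + 1) 1)) h
  have h6 := congrArg (coeff (expo 1 (r + 2) (r + 1))) h
  simp (disch := omega) only [conicForm, coeff_add, coeff_monomial, expo_inj, if_neg,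
    add_zero, zero_add] at h1 h2 h3 h4 h5 h6
  exact ⟨h1, h2, h3, h4, h5, h6⟩

theorem C_mul_conicForm (r : ℕ) (c A₀ A₁ A₂ B₀ B₁ B₂ : L) :
    C c * conicForm r A₀ A₁ A₂ B₀ B₁ B₂ =
      conicForm r (c * A₀) (c * A₁) (c * A₂) (c * B₀) (c * B₁) (c * B₂) := by
  simp only [conicForm, mul_add, C_mul_monomial]

theorem aeval_rotate_conicForm (r : ℕ) (A₀ A₁ A₂ B₀ B₁ B₂ : L) :
    aeval (R := L) ![X 2, X 0, (X 1 : MvPolynomial (Fin 3) L)] (conicForm r A₀ A₁ A₂ B₀ B₁ B₂) =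
      conicForm r A₂ A₀ A₁ B₁ B₂ B₀ := by
  simp only [conicForm, monomial_expo, map_add, map_mul, map_pow, aeval_X, aeval_C, algebraMap_eq,
    Matrix.cons_val]
  ring

/-- A homogeneous polynomial all of whose monomials are among the six monomials of `conicForm`. -/
theorem exists_eq_conicForm {r : ℕ} {F : MvPolynomial (Fin 3) L}
    (hF : ∀ d ∈ F.support, d ∈ ({expo (2 * r + 2) 0 2, expo 0 2 (2 * r + 2), expo 2 (2 * r + 2) 0,
      expo (r + 1) 1 (r + 2), expo (r + 2) (r + 1) 1, expo 1 (r + 2) (r + 1)} :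
        Set (Fin 3 →₀ ℕ))) :
    ∃ A₀ A₁ A₂ B₀ B₁ B₂ : L, F = conicForm r A₀ A₁ A₂ B₀ B₁ B₂ := by
  rw [F.as_sum]
  refine Finset.sum_induction (fun d => monomial d (coeff d F))
    (fun G => ∃ A₀ A₁ A₂ B₀ B₁ B₂ : L, G = conicForm r A₀ A₁ A₂ B₀ B₁ B₂) ?_ ?_ ?_
  · rintro _ _ ⟨A₀, A₁, A₂, B₀, B₁, B₂, rfl⟩ ⟨A₀', A₁', A₂', B₀', B₁', B₂', rfl⟩
    refine ⟨A₀ + A₀', A₁ + A₁', A₂ + A₂', B₀ + B₀', B₁ + B₁', B₂ + B₂', ?_⟩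
    simp only [conicForm, map_add]
    ring
  · exact ⟨0, 0, 0, 0, 0, 0, by simp [conicForm]⟩
  · intro d hd
    rcases hF d hd with h | h | h | h | h | h <;> rw [h] <;>
      generalize coeff _ F = c
    · exact ⟨c, 0, 0, 0, 0, 0, by simp only [conicForm, map_zero, add_zero]⟩
    · exact ⟨0, c, 0, 0, 0, 0, by simp only [conicForm, map_zero, add_zero, zero_add]⟩
    · exact ⟨0, 0, c, 0, 0, 0, by simp only [conicForm, map_zero, add_zero, zero_add]⟩
    · exact ⟨0, 0, 0, c, 0, 0, by simp only [conicForm, map_zero, add_zero, zero_add]⟩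
    · exact ⟨0, 0, 0, 0, c, 0, by simp only [conicForm, map_zero, add_zero, zero_add]⟩
    · exact ⟨0, 0, 0, 0, 0, c, by simp only [conicForm, map_zero, add_zero, zero_add]⟩

/-- The quadratic polynomial with given coefficients. -/
noncomputable def quadric (A₀ A₁ A₂ B₀ B₁ B₂ : L) : MvPolynomial (Fin 2) L :=
  C A₀ + C A₁ * X 0 ^ 2 + C A₂ * X 1 ^ 2 + C B₀ * X 0 + C B₁ * X 1 + C B₂ * (X 0 * X 1)

theorem exists_eq_quadric {Q : MvPolynomial (Fin 2) L} (hQ : Q.totalDegree ≤ 2) :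
    ∃ A₀ A₁ A₂ B₀ B₁ B₂ : L, Q = quadric A₀ A₁ A₂ B₀ B₁ B₂ := by
  rw [Q.as_sum]
  refine Finset.sum_induction (fun d => monomial d (coeff d Q))
    (fun G => ∃ A₀ A₁ A₂ B₀ B₁ B₂ : L, G = quadric A₀ A₁ A₂ B₀ B₁ B₂) ?_ ?_ ?_
  · rintro _ _ ⟨A₀, A₁, A₂, B₀, B₁, B₂, rfl⟩ ⟨A₀', A₁', A₂', B₀', B₁', B₂', rfl⟩
    refine ⟨A₀ + A₀', A₁ + A₁', A₂ + A₂', B₀ + B₀', B₁ + B₁', B₂ + B₂', ?_⟩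
    simp only [quadric, map_add]
    ring
  · exact ⟨0, 0, 0, 0, 0, 0, by simp [quadric]⟩
  · intro d hd
    have hdeg := (le_totalDegree hd).trans hQ
    rw [Finsupp.sum_fintype _ _ (by simp), Fin.sum_univ_two] at hdeg
    rw [monomial_fin_two]
    generalize coeff d Q = c
    generalize d 0 = i at *
    generalize d 1 = j at *
    have hi : i ≤ 2 := by omega
    have hj : j ≤ 2 := by omega
    interval_cases i <;> interval_cases j <;> first | omega | skip
    · exact ⟨c, 0, 0, 0, 0, 0, by simp [quadric]⟩
    · exact ⟨0, 0, 0, 0, c, 0, by simp [quadric]⟩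
    · exact ⟨0, 0, c, 0, 0, 0, by simp [quadric]⟩
    · exact ⟨0, 0, 0, c, 0, 0, by simp [quadric]⟩
    · exact ⟨0, 0, 0, 0, 0, c, by simp [quadric, mul_assoc]⟩
    · exact ⟨0, c, 0, 0, 0, 0, by simp [quadric]⟩

theorem exists_eq_linear {Q : MvPolynomial (Fin 2) L} (hQ : Q.totalDegree ≤ 1) :
    ∃ a b c : L, Q = C a + C b * X 0 + C c * X 1 := by
  rw [Q.as_sum]
  refine Finset.sum_induction (fun d => monomial d (coeff d Q))
    (fun G => ∃ a b c : L, G = C a + C b * X 0 + C c * X 1) ?_ ?_ ?_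
  · rintro _ _ ⟨a, b, c, rfl⟩ ⟨a', b', c', rfl⟩
    refine ⟨a + a', b + b', c + c', ?_⟩
    simp only [map_add]
    ring
  · exact ⟨0, 0, 0, by simp⟩
  · intro d hd
    have hdeg := (le_totalDegree hd).trans hQ
    rw [Finsupp.sum_fintype _ _ (by simp), Fin.sum_univ_two] at hdeg
    rw [monomial_fin_two]
    generalize coeff d Q = c
    generalize d 0 = i at *
    generalize d 1 = j at *
    have hi : i ≤ 1 := by omega
    have hj : j ≤ 1 := by omega
    interval_cases i <;> interval_cases j <;> first | omega | skip
    · exact ⟨c, 0, 0, by simp⟩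
    · exact ⟨0, 0, c, by simp⟩
    · exact ⟨0, c, 0, by simp⟩

theorem totalDegree_quadric {A₀ A₁ A₂ B₀ B₁ B₂ : L} (hA : A₁ ≠ 0) :
    (quadric A₀ A₁ A₂ B₀ B₁ B₂).totalDegree = 2 := by
  classical
  refine le_antisymm ?_ ?_
  · have hC : ∀ (c : L) (G : MvPolynomial (Fin 2) L), G.totalDegree ≤ 2 →
        (C c * G).totalDegree ≤ 2 := fun c G hG =>
      (totalDegree_mul _ _).trans (by rw [totalDegree_C, zero_add]; exact hG)
    have hadd : ∀ G H : MvPolynomial (Fin 2) L, G.totalDegree ≤ 2 → H.totalDegree ≤ 2 →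
        (G + H).totalDegree ≤ 2 := fun G H hG hH => (totalDegree_add _ _).trans (max_le hG hH)
    refine hadd _ _ (hadd _ _ (hadd _ _ (hadd _ _ (hadd _ _ ?_ ?_) ?_) ?_) ?_) ?_
    · simp
    · exact hC _ _ (by simp)
    · exact hC _ _ (by simp)
    · exact hC _ _ (by simp)
    · exact hC _ _ (by simp)
    · exact hC _ _ ((totalDegree_mul _ _).trans (by simp))
  · have hcoeff : coeff (Finsupp.single 0 2) (quadric A₀ A₁ A₂ B₀ B₁ B₂) = A₁ := by
      have h1 : (Finsupp.single 1 2 : Fin 2 →₀ ℕ) ≠ Finsupp.single 0 2 := fun h => by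
        simpa using DFunLike.congr_fun h 1
      have h2 : (Finsupp.single 0 1 : Fin 2 →₀ ℕ) ≠ Finsupp.single 0 2 := fun h => by
        simpa using DFunLike.congr_fun h 0
      have h3 : (Finsupp.single 1 1 : Fin 2 →₀ ℕ) ≠ Finsupp.single 0 2 := fun h => by
        simpa using DFunLike.congr_fun h 1
      have h4 : (Finsupp.single 0 1 + Finsupp.single 1 1 : Fin 2 →₀ ℕ) ≠ Finsupp.single 0 2 :=
        fun h => by simpa using DFunLike.congr_fun h 1
      have h5 : (0 : Fin 2 →₀ ℕ) ≠ Finsupp.single 0 2 := fun h => by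
        simpa using DFunLike.congr_fun h 0
      have h6 : (X 0 * X 1 : MvPolynomial (Fin 2) L) =
          monomial (Finsupp.single 0 1 + Finsupp.single 1 1) 1 := by
        rw [X, X, monomial_mul, one_mul]
      rw [quadric, h6]
      simp only [coeff_add, coeff_C_mul, coeff_X_pow, coeff_X, coeff_C, coeff_monomial, if_neg h1,
        if_neg h2, if_neg h3, if_neg h4, if_neg h5, if_true]
      ring
    have := le_totalDegree (p := quadric A₀ A₁ A₂ B₀ B₁ B₂) (s := Finsupp.single 0 2)
      (by rw [mem_support_iff, hcoeff]; exact hA)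
    simpa using this

end ConicForm

/-! ### The equation of the curve and the ideal of its image -/

section Curve

variable {L : Type*} [Field L]

theorem MvPolynomial.IsHomogeneous.eq_zero_of_dvd {σ : Type*} {F G : MvPolynomial σ L} {m n : ℕ}
    (hF : F.IsHomogeneous m) (hG : G.IsHomogeneous n) (hdvd : F ∣ G) (hnm : n < m) : G = 0 := by
  by_contra hG0
  obtain ⟨H, rfl⟩ := hdvd
  have h1 := totalDegree_mul_of_isDomain (left_ne_zero_of_mul hG0) (right_ne_zero_of_mul hG0)
  rw [hG.totalDegree hG0, hF.totalDegree (left_ne_zero_of_mul hG0)] at h1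
  omega

theorem MvPolynomial.IsHomogeneous.eq_C_mul_of_dvd {σ : Type*} {F G : MvPolynomial σ L} {n : ℕ}
    (hF : F.IsHomogeneous n) (hG : G.IsHomogeneous n) (hdvd : F ∣ G) (hG0 : G ≠ 0) :
    ∃ c : L, F = C c * G := by
  obtain ⟨H, rfl⟩ := hdvd
  have h1 := totalDegree_mul_of_isDomain (left_ne_zero_of_mul hG0) (right_ne_zero_of_mul hG0)
  rw [hG.totalDegree hG0, hF.totalDegree (left_ne_zero_of_mul hG0)] at h1
  obtain ⟨a, rfl⟩ : ∃ a : L, H = C a :=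
    ⟨_, totalDegree_eq_zero_iff_eq_C.1 (show H.totalDegree = 0 by omega)⟩
  have ha : a ≠ 0 := by
    rintro rfl
    simp at hG0
  refine ⟨a⁻¹, ?_⟩
  rw [mul_left_comm, ← MvPolynomial.C_mul, inv_mul_cancel₀ ha, C_1, mul_one]

namespace IrredPlaneCurve

theorem aeval_coord {n : ℕ} (C : IrredPlaneCurve L n) (G : MvPolynomial (Fin 3) L) :
    aeval C.coord G = algebraMap C.CoordRing _ (Ideal.Quotient.mk (Ideal.span {C.eqn}) G) := by
  have h := aeval_unique ((IsScalarTower.toAlgHom L C.CoordRing (FractionRing C.CoordRing)).comp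
    (Ideal.Quotient.mkₐ L (Ideal.span {C.eqn})))
  exact (DFunLike.congr_fun h G).symm

theorem aeval_coord_eq_zero_iff {n : ℕ} (C : IrredPlaneCurve L n) (G : MvPolynomial (Fin 3) L) :
    aeval C.coord G = 0 ↔ C.eqn ∣ G := by
  rw [aeval_coord, FaithfulSMul.algebraMap_eq_zero_iff, Ideal.Quotient.eq_zero_iff_mem,
    Ideal.mem_span_singleton]

theorem coord_ne_zero {n : ℕ} (C : IrredPlaneCurve L n) (hn : 1 < n) (i : Fin 3) :
    C.coord i ≠ 0 := by
  intro h0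
  have h1 : C.eqn ∣ X i := by
    rw [← C.aeval_coord_eq_zero_iff, aeval_X, h0]
  exact X_ne_zero i (C.homogeneous.eq_zero_of_dvd (isHomogeneous_X L i) h1 hn)

theorem ratio_ne_zero {n : ℕ} (C : IrredPlaneCurve L n) (hn : 1 < n) (i j : Fin 3) :
    C.ratio i j ≠ 0 := fun h =>
  div_ne_zero (C.coord_ne_zero hn i) (C.coord_ne_zero hn j) (congrArg Subtype.val h)

theorem adjoin_x_y {n : ℕ} (C : IrredPlaneCurve L n) (hn : 1 < n) :
    IntermediateField.adjoin L {C.x, C.y} = ⊤ := by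
  set M := IntermediateField.adjoin L {C.x, C.y} with hM
  have hx : C.x ∈ M := IntermediateField.subset_adjoin _ _ (by simp)
  have hy : C.y ∈ M := IntermediateField.subset_adjoin _ _ (by simp)
  have h2 : ∀ i, C.ratio i 2 ∈ M := by
    intro i
    fin_cases i
    · exact hx
    · exact hy
    · have : C.ratio 2 2 = 1 := Subtype.ext (div_self (C.coord_ne_zero hn 2))
      change C.ratio 2 2 ∈ M
      rw [this]
      exact one_mem _
  have hratio : ∀ i j, C.ratio i j ∈ M := by
    intro i j
    have : C.ratio i j = C.ratio i 2 / C.ratio j 2 := by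
      refine Subtype.ext ?_
      change C.coord i / C.coord j = (C.coord i / C.coord 2) / (C.coord j / C.coord 2)
      rw [div_div_div_cancel_right₀ (C.coord_ne_zero hn 2)]
    rw [this]
    exact div_mem (h2 i) (h2 j)
  have hle : IntermediateField.adjoin L
      (Set.range fun ij : Fin 3 × Fin 3 => C.coord ij.1 / C.coord ij.2) ≤
        IntermediateField.lift M := by
    rw [IntermediateField.adjoin_le_iff]
    rintro _ ⟨⟨i, j⟩, rfl⟩
    exact (IntermediateField.mem_lift (C.ratio i j)).2 (hratio i j)
  exact top_unique fun f _ => (IntermediateField.mem_lift f).1 (hle f.2)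

section Phi

variable {r : ℕ} (C : IrredPlaneCurve L (2 * (r + 2)))

theorem phi₁_coe : (C.phi₁ (r + 2) : FractionRing C.CoordRing) =
    (C.coord 1 / C.coord 2) / (C.coord 0 / C.coord 2) ^ (r + 1) := rfl

theorem phi₂_coe : (C.phi₂ (r + 2) : FractionRing C.CoordRing) =
    (C.coord 1 / C.coord 2) ^ (r + 1) / (C.coord 0 / C.coord 2) ^ r := rfl

/-- With `mul_phi₂`: in homogeneous coordinates Φ is (x₁^(r+1) x₃ : x₂ x₃^(r+1) : x₁ x₂^(r+1)), so
x₁^(r+1) x₃ is a common denominator. -/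
theorem mul_phi₁ : C.coord 0 ^ (r + 1) * C.coord 2 * (C.phi₁ (r + 2) : FractionRing C.CoordRing) =
    C.coord 2 ^ (r + 1) * C.coord 1 := by
  have h0 := C.coord_ne_zero (by omega) 0
  have h2 := C.coord_ne_zero (by omega) 2
  rw [phi₁_coe, div_pow]
  field_simp

theorem mul_phi₂ : C.coord 0 ^ (r + 1) * C.coord 2 * (C.phi₂ (r + 2) : FractionRing C.CoordRing) =
    C.coord 1 ^ (r + 1) * C.coord 0 := by
  have h0 := C.coord_ne_zero (by omega) 0
  have h2 := C.coord_ne_zero (by omega) 2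
  rw [phi₂_coe, div_pow, div_pow]
  field_simp
  ring

theorem aeval_lineForm (a b c : L) : aeval C.coord (lineForm r a b c) =
    C.coord 0 ^ (r + 1) * C.coord 2 * ((algebraMap L C.FunctionField a +
      algebraMap L C.FunctionField b * C.phi₁ (r + 2) +
      algebraMap L C.FunctionField c * C.phi₂ (r + 2) : C.FunctionField) :
        FractionRing C.CoordRing) := by
  push_cast
  have h1 := C.mul_phi₁
  have h2 := C.mul_phi₂
  simp only [lineForm, monomial_expo, map_add, map_mul, map_pow, aeval_X, aeval_C]
  change _ = C.coord 0 ^ (r + 1) * C.coord 2 * (algebraMap L _ a +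
    algebraMap L _ b * (C.phi₁ (r + 2) : FractionRing C.CoordRing) +
    algebraMap L _ c * (C.phi₂ (r + 2) : FractionRing C.CoordRing))
  linear_combination (-algebraMap L _ b) * h1 - algebraMap L _ c * h2

theorem aeval_conicForm (A₀ A₁ A₂ B₀ B₁ B₂ : L) :
    aeval C.coord (conicForm r A₀ A₁ A₂ B₀ B₁ B₂) =
    (C.coord 0 ^ (r + 1) * C.coord 2) ^ 2 *
      ((aeval (R := L) ![C.phi₁ (r + 2), C.phi₂ (r + 2)] (quadric A₀ A₁ A₂ B₀ B₁ B₂) :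
        C.FunctionField) : FractionRing C.CoordRing) := by
  have h1 := C.mul_phi₁
  have h2 := C.mul_phi₂
  simp only [conicForm, quadric, monomial_expo, map_add, map_mul, map_pow, aeval_X, aeval_C,
    Matrix.cons_val_zero, Matrix.cons_val_one]
  push_cast
  change _ = (C.coord 0 ^ (r + 1) * C.coord 2) ^ 2 * (algebraMap L _ A₀ +
    algebraMap L _ A₁ * (C.phi₁ (r + 2) : FractionRing C.CoordRing) ^ 2 +
    algebraMap L _ A₂ * (C.phi₂ (r + 2) : FractionRing C.CoordRing) ^ 2 +
    algebraMap L _ B₀ * (C.phi₁ (r + 2) : FractionRing C.CoordRing) +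
    algebraMap L _ B₁ * (C.phi₂ (r + 2) : FractionRing C.CoordRing) +
    algebraMap L _ B₂ * ((C.phi₁ (r + 2) : FractionRing C.CoordRing) *
      (C.phi₂ (r + 2) : FractionRing C.CoordRing)))
  set ξ := (C.phi₁ (r + 2) : FractionRing C.CoordRing)
  set η := (C.phi₂ (r + 2) : FractionRing C.CoordRing)
  set m := C.coord 0 ^ (r + 1) * C.coord 2 with hm
  have e : ∀ a₀ a₁ a₂ b₀ b₁ b₂ : FractionRing C.CoordRing,
      m ^ 2 * (a₀ + a₁ * ξ ^ 2 + a₂ * η ^ 2 + b₀ * ξ + b₁ * η + b₂ * (ξ * η)) =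
      a₀ * m ^ 2 + a₁ * (m * ξ) ^ 2 + a₂ * (m * η) ^ 2 + b₀ * m * (m * ξ) + b₁ * m * (m * η) +
        b₂ * (m * ξ) * (m * η) := fun _ _ _ _ _ _ => by ring
  rw [e, h1, h2, hm]
  ring

/-- A linear relation pulls back to a form of degree r + 2 divisible by the equation of C, whose
degree is 2(r + 2). Hence the image is never a line. -/
theorem linear_independent {a b c : L} (h : algebraMap L C.FunctionField a +
    algebraMap L C.FunctionField b * C.phi₁ (r + 2) +
    algebraMap L C.FunctionField c * C.phi₂ (r + 2) = 0) : a = 0 ∧ b = 0 ∧ c = 0 := by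
  have h1 := C.aeval_lineForm a b c
  rw [h, ZeroMemClass.coe_zero, mul_zero, aeval_coord_eq_zero_iff] at h1
  exact eq_zero_of_lineForm_eq_zero
    (C.homogeneous.eq_zero_of_dvd (lineForm_isHomogeneous r a b c) h1 (by omega))

theorem dvd_conicForm_iff (A₀ A₁ A₂ B₀ B₁ B₂ : L) :
    C.eqn ∣ conicForm r A₀ A₁ A₂ B₀ B₁ B₂ ↔
      aeval (R := L) ![C.phi₁ (r + 2), C.phi₂ (r + 2)] (quadric A₀ A₁ A₂ B₀ B₁ B₂) = 0 := by
  have h0 := C.coord_ne_zero (by omega) 0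
  have h2 := C.coord_ne_zero (by omega) 2
  rw [← aeval_coord_eq_zero_iff, aeval_conicForm, mul_eq_zero,
    or_iff_right (pow_ne_zero 2 (mul_ne_zero (pow_ne_zero _ h0) h2))]
  exact ZeroMemClass.coe_eq_zero

theorem totalDegree_of_mem_ker {Q : MvPolynomial (Fin 2) L} (hQ0 : Q ≠ 0)
    (hQ : aeval (R := L) ![C.phi₁ (r + 2), C.phi₂ (r + 2)] Q = 0) : 2 ≤ Q.totalDegree := by
  by_contra! hlt
  obtain ⟨a, b, c, rfl⟩ := exists_eq_linear (Q := Q) (by omega)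
  simp only [map_add, map_mul, aeval_X, aeval_C, Matrix.cons_val_zero, Matrix.cons_val_one] at hQ
  obtain ⟨rfl, rfl, rfl⟩ := C.linear_independent hQ
  simp at hQ0

theorem exists_eqn_eq_conicForm_of_imageIsConicOrLine (h : C.ImageIsConicOrLine (r + 2)) :
    ∃ A₀ A₁ A₂ B₀ B₁ B₂ : L, C.eqn = conicForm r A₀ A₁ A₂ B₀ B₁ B₂ := by
  obtain ⟨Q, hdeg, hker⟩ := h
  have hQ0 : Q ≠ 0 := by
    rintro rfl
    simp at hdeg
  have hQ : aeval (R := L) ![C.phi₁ (r + 2), C.phi₂ (r + 2)] Q = 0 := by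
    have : Q ∈ Ideal.span {Q} := Ideal.mem_span_singleton_self Q
    rwa [← hker] at this
  obtain ⟨A₀, A₁, A₂, B₀, B₁, B₂, rfl⟩ := exists_eq_quadric (Q := Q) (by omega)
  have hdvd := (C.dvd_conicForm_iff A₀ A₁ A₂ B₀ B₁ B₂).2 hQ
  have hG0 : conicForm r A₀ A₁ A₂ B₀ B₁ B₂ ≠ 0 := by
    intro h0
    have h1 : conicForm r A₀ A₁ A₂ B₀ B₁ B₂ = conicForm r 0 0 0 0 0 0 := by
      rw [h0]
      simp [conicForm]
    obtain ⟨rfl, rfl, rfl, rfl, rfl, rfl⟩ := conicForm_inj h1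
    simp [quadric] at hQ0
  obtain ⟨c, hc⟩ := C.homogeneous.eq_C_mul_of_dvd (conicForm_isHomogeneous r _ _ _ _ _ _) hdvd hG0
  rw [C_mul_conicForm] at hc
  exact ⟨_, _, _, _, _, _, hc⟩

/-- The quadric Q is irreducible because a proper factor in the prime kernel would be linear. A
kernel larger than (Q) would have height 2 and so be maximal; by the Nullstellensatz ξ would then be
constant. -/
theorem imageIsConicOrLine_of_eqn_eq_conicForm [IsAlgClosed L] {A₀ A₁ A₂ B₀ B₁ B₂ : L}
    (h : C.eqn = conicForm r A₀ A₁ A₂ B₀ B₁ B₂) (hA : A₁ ≠ 0) : C.ImageIsConicOrLine (r + 2) := by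
  set Q := quadric A₀ A₁ A₂ B₀ B₁ B₂ with hQdef
  have hdeg : Q.totalDegree = 2 := totalDegree_quadric hA
  refine ⟨Q, Or.inr hdeg, ?_⟩
  set I := RingHom.ker (aeval (R := L) ![C.phi₁ (r + 2), C.phi₂ (r + 2)]) with hI
  have hprime : I.IsPrime := RingHom.ker_isPrime _
  have hmem : ∀ {G : MvPolynomial (Fin 2) L}, G ∈ I ↔
    aeval (R := L) ![C.phi₁ (r + 2), C.phi₂ (r + 2)] G = 0 := Iff.rfl
  have hQI : Q ∈ I := hmem.2 ((C.dvd_conicForm_iff A₀ A₁ A₂ B₀ B₁ B₂).1 (by rw [h]))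
  have hQ0 : Q ≠ 0 := by
    rintro h0
    rw [h0] at hdeg
    simp at hdeg
  have hunit : ∀ G H : MvPolynomial (Fin 2) L, Q = G * H → G ∈ I → IsUnit H := by
    intro G H hGH hG
    have hG0 : G ≠ 0 := by rintro rfl; rw [zero_mul] at hGH; exact hQ0 hGH
    have hH0 : H ≠ 0 := by rintro rfl; rw [mul_zero] at hGH; exact hQ0 hGH
    have h1 := C.totalDegree_of_mem_ker hG0 hG
    have h2 := totalDegree_mul_of_isDomain hG0 hH0
    rw [← hGH, hdeg] at h2
    have h3 := totalDegree_eq_zero_iff_eq_C.1 (show H.totalDegree = 0 by omega)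
    rw [h3]
    refine IsUnit.map MvPolynomial.C (isUnit_iff_ne_zero.2 fun h0 => hH0 ?_)
    rw [h3, h0, C_0]
  have hirr : Irreducible Q := by
    refine ⟨fun hu => hprime.ne_top (Ideal.eq_top_of_isUnit_mem _ hQI hu), fun G H hGH => ?_⟩
    rcases hprime.mem_or_mem (hGH ▸ hQI) with hG | hH
    · exact Or.inr (hunit G H hGH hG)
    · exact Or.inl (hunit H G (by rw [hGH, mul_comm]) hH)
  have hspan : (Ideal.span {Q}).IsPrime :=
    (Ideal.span_singleton_prime hQ0).2 hirr.prime
  by_contra hne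
  have hlt : Ideal.span {Q} < I :=
    lt_of_le_of_ne ((Ideal.span_singleton_le_iff_mem I).2 hQI) (Ne.symm hne)
  have hbot : (⊥ : Ideal (MvPolynomial (Fin 2) L)) < Ideal.span {Q} :=
    bot_lt_iff_ne_bot.2 (by rwa [ne_eq, Ideal.span_singleton_eq_bot])
  have hbp : (⊥ : Ideal (MvPolynomial (Fin 2) L)).IsPrime := Ideal.isPrime_bot
  have hdim : ringKrullDim (MvPolynomial (Fin 2) L) = 2 := by
    rw [MvPolynomial.ringKrullDim_of_isNoetherianRing, ringKrullDim_eq_zero_of_field]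
    simp
  have hh : (2 : ℕ∞) ≤ I.height := by
    have h1 := Ideal.height_add_one_le_of_lt_of_isPrime hbot
    have h2 := Ideal.height_add_one_le_of_lt_of_isPrime hlt
    calc (2 : ℕ∞) = 0 + 1 + 1 := by norm_num
      _ ≤ _ := add_le_add_left (add_le_add_left zero_le 1) 1
      _ ≤ _ := (add_le_add_left h1 1).trans h2
  have hfd : FiniteRingKrullDim (MvPolynomial (Fin 2) L) :=
    (finiteRingKrullDim_iff_ne_bot_and_top).2 (by rw [hdim]; exact ⟨by decide, by decide⟩)
  have hmax : I.IsMaximal := by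
    refine Ideal.isMaximal_of_height_eq_ringKrullDim (le_antisymm
      Ideal.height_le_ringKrullDim_of_isPrime ?_)
    rw [hdim]
    exact WithBot.coe_le_coe.2 hh
  obtain ⟨a, ha⟩ := isMaximal_iff_eq_vanishingIdeal_singleton.1 hmax
  have hX : X 0 - MvPolynomial.C (a 0) ∈ I := by
    rw [ha, mem_vanishingIdeal_singleton_iff]
    simp
  have h1 := hmem.1 hX
  simp only [map_sub, aeval_X, aeval_C, Matrix.cons_val_zero] at h1
  have h2 := C.linear_independent (a := -a 0) (b := 1) (c := 0) (by
    rw [map_neg, map_one, map_zero]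
    linear_combination h1)
  exact one_ne_zero h2.2.1

end Phi

end IrredPlaneCurve

end Curve

/-! ### Arithmetic of exponents -/

section Lattice

/-- The hypotheses compare the β-weight of a monomial x₁^i x₃^l with those of its two rotations. The
bound r ≥ 5 leaves room for only one exponent. -/
theorem eq_of_dvd_of_zero_coordinate {r i l : ℤ} (hr : 5 ≤ r) (hi : 0 ≤ i) (hl : 0 ≤ l)
    (hsum : i + l = 2 * (r + 2)) (h1 : (r + 1) * r + 1 ∣ i - (r + 1) * l)
    (h2 : (r + 1) * r + 1 ∣ i - (l + (r + 1) * i)) : i = 2 * r + 2 := by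
  obtain ⟨δ, rfl⟩ : ∃ δ, i = 2 * r + 2 + δ := ⟨i - (2 * r + 2), by ring⟩
  obtain rfl : l = 2 - δ := by linear_combination hsum
  obtain ⟨u, hu⟩ := h1
  obtain ⟨v, hv⟩ := h2
  -- The two weight differences add up to 3δ - 2N.
  have h3 : 3 * δ = ((r + 1) * r + 1) * (u + v + 2) := by linear_combination hu + hv
  suffices δ = 0 by omega
  set w := u + v + 2
  have hM : 6 * r + 1 ≤ (r + 1) * r + 1 := by nlinarith
  have hlow : -(6 * r + 6) ≤ 3 * δ := by omega
  have hup : 3 * δ ≤ 6 := by omega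
  have hw0 : w < 1 := by
    by_contra! hcon
    have := mul_le_mul_of_nonneg_left hcon (show 0 ≤ (r + 1) * r + 1 by linarith)
    linarith
  have hw1 : -2 < w := by
    by_contra! hcon
    have := mul_le_mul_of_nonneg_left (show w ≤ -2 by omega)
      (show 0 ≤ (r + 1) * r + 1 by linarith)
    linarith
  rcases (show w = 0 ∨ w = -1 by omega) with hw | hw
  · rw [hw] at h3
    omega
  -- Here 3δ = -N. For r = 5 this fails since 3 does not divide 31; for r ≥ 6, N exceeds 6r + 6.
  · rw [hw] at h3
    rcases (show r = 5 ∨ 6 ≤ r by omega) with rfl | hr6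
    · omega
    · nlinarith

/-- Relative to x₁^(2r+2) x₃², the admissible monomials are ξ^a η^b with integers a, b. Nonnegative
exponents cut out the triangle a, b ≥ 0, a + b ≤ 2, whose six points are the monomials of a conic.
-/
theorem mem_of_dvd {r i j l : ℤ} (hr : 3 ≤ r) (hi : 0 ≤ i) (hj : 0 ≤ j) (hl : 0 ≤ l)
    (hsum : i + j + l = 2 * (r + 2)) (h : (r + 1) * r + 1 ∣ i + (r + 1) * j - (2 * r + 2)) :
    (i = 2 * r + 2 ∧ j = 0 ∧ l = 2) ∨ (i = 0 ∧ j = 2 ∧ l = 2 * r + 2) ∨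
      (i = 2 ∧ j = 2 * r + 2 ∧ l = 0) ∨ (i = r + 1 ∧ j = 1 ∧ l = r + 2) ∨
      (i = r + 2 ∧ j = r + 1 ∧ l = 1) ∨ (i = 1 ∧ j = r + 2 ∧ l = r + 1) := by
  obtain ⟨b, hb⟩ := h
  obtain ⟨a, rfl⟩ : ∃ a, j = a + (r + 1) * b := ⟨j - (r + 1) * b, by ring⟩
  obtain rfl : i = 2 * r + 2 - (r + 1) * a - r * b := by linear_combination hb
  obtain rfl : l = 2 + r * a - b := by linear_combination hsum
  have hb0 : 0 ≤ b := by
    by_contra! hcon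
    have h1 : -((r + 1) * b) ≤ a := by linarith
    have h2 : (r + 1) * (-((r + 1) * b)) ≤ (r + 1) * a := mul_le_mul_of_nonneg_left h1 (by linarith)
    have h3 : (r ^ 2 + r + 1) * 1 ≤ (r ^ 2 + r + 1) * (-b) :=
      mul_le_mul_of_nonneg_left (by omega) (by nlinarith)
    nlinarith
  have ha0 : 0 ≤ a := by
    by_contra! hcon
    have : r * a ≤ r * (-1) := mul_le_mul_of_nonneg_left (by omega) (by linarith)
    linarith
  have hab : a + b ≤ 2 := by
    by_contra! hcon
    have h1 : (r + 1) * 3 ≤ (r + 1) * (a + b) := mul_le_mul_of_nonneg_left (by omega) (by linarith)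
    have h2 : r + 1 ≤ b := by linarith
    have h3 : r * (r + 1) ≤ r * b := mul_le_mul_of_nonneg_left h2 (by linarith)
    have h4 : 0 ≤ (r + 1) * a := by positivity
    nlinarith
  have ha2 : a ≤ 2 := by omega
  have hb2 : b ≤ 2 := by omega
  interval_cases a <;> interval_cases b <;> omega

end Lattice

/-! ### Forms invariant under the collineation group -/

section Support

variable {L : Type*} [Field L]

theorem coeff_aeval_C_mul_X {σ : Type*} [Fintype σ] (w : σ → L) (F : MvPolynomial σ L)
    (d : σ →₀ ℕ) :
    coeff d (aeval (R := L) (fun i => C (w i) * X i) F) = (∏ i, w i ^ d i) * coeff d F := by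
  classical
  induction F using MvPolynomial.induction_on' with
  | monomial u a =>
    have h : aeval (R := L) (fun i => C (w i) * X i) (monomial u a) =
        monomial u (a * ∏ i, w i ^ u i) := by
      rw [aeval_monomial, Finsupp.prod_fintype _ _ (by simp), algebraMap_eq, monomial_eq,
        Finsupp.prod_fintype _ _ (by simp)]
      simp only [mul_pow, Finset.prod_mul_distrib, map_mul, map_prod, map_pow]
      ring
    rw [h, coeff_monomial, coeff_monomial]
    split_ifs with hu
    · rw [hu, mul_comm]
    · rw [mul_zero]
  | add p q hp hq => rw [map_add, coeff_add, hp, hq, coeff_add, mul_add]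

theorem exists_coeff_ne_zero_of_not_X_dvd {σ : Type*} {F : MvPolynomial σ L} {i : σ}
    (h : ¬ X i ∣ F) : ∃ d : σ →₀ ℕ, coeff d F ≠ 0 ∧ d i = 0 := by
  by_contra! hcon
  refine h ?_
  rw [F.as_sum]
  refine Finset.dvd_sum fun d hd => ?_
  exact X_dvd_monomial.2 (Or.inr (hcon d (mem_support_iff.1 hd)))

theorem coeff_rotate {F : MvPolynomial (Fin 3) L} {c : L}
    (hF : aeval (R := L) ![X 2, X 0, (X 1 : MvPolynomial (Fin 3) L)] F = C c * F) {i j l : ℕ}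
    (h : coeff (expo i j l) F ≠ 0) : coeff (expo j l i) F ≠ 0 := by
  let σ : Fin 3 → Fin 3 := ![2, 0, 1]
  have hσ : Function.Injective σ := by decide
  have h1 : aeval (R := L) ![X 2, X 0, (X 1 : MvPolynomial (Fin 3) L)] F = rename σ F := by
    refine DFunLike.congr_fun (algHom_ext fun k => ?_) F
    rw [aeval_X, rename_X]
    fin_cases k <;> rfl
  have h2 : (expo i j l).mapDomain σ = expo j l i := by
    rw [eq_expo ((expo i j l).mapDomain σ)]
    congr 1
    · exact Finsupp.mapDomain_apply hσ (expo i j l) 1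
    · exact Finsupp.mapDomain_apply hσ (expo i j l) 2
    · exact Finsupp.mapDomain_apply hσ (expo i j l) 0
  have h3 := coeff_rename_mapDomain σ hσ F (expo i j l)
  rw [← h1, hF, h2, coeff_C_mul] at h3
  intro h0
  rw [h0, mul_zero] at h3
  exact h h3.symm

/-- A form of degree `2 * (r + 2)` that is preserved by the cyclic group of order `r ^ 2 + r + 1`
and by the cyclic permutation of the coordinates is the pullback of a conic. -/
theorem exists_eq_conicForm_of_invariant {r : ℕ} (hr : 5 ≤ r) {F : MvPolynomial (Fin 3) L}
    (hhom : F.IsHomogeneous (2 * (r + 2))) {b : L} (hb : IsPrimitiveRoot b ((r + 1) * r + 1))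
    {Q : ℕ} (hQ : Q ≡ r + 1 [MOD (r + 1) * r + 1]) {c c' : L}
    (hβ : aeval (R := L) ![C b * X 0, C (b ^ Q) * X 1, (X 2 : MvPolynomial (Fin 3) L)] F = C c * F)
    (hμ : aeval (R := L) ![X 2, X 0, (X 1 : MvPolynomial (Fin 3) L)] F = C c' * F)
    (hX : ¬ X 1 ∣ F) : ∃ A₀ A₁ A₂ B₀ B₁ B₂ : L, F = conicForm r A₀ A₁ A₂ B₀ B₁ B₂ := by
  have hsum : ∀ {i j l : ℕ}, coeff (expo i j l) F ≠ 0 → i + j + l = 2 * (r + 2) := by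
    intro i j l h
    have := hhom h
    rw [Finsupp.weight_apply, Finsupp.sum_fintype _ _ (by simp), Fin.sum_univ_three] at this
    simpa [expo] using this
  have hbQ : b ^ Q = b ^ (r + 1) := by
    rw [← pow_mod_orderOf b Q, ← pow_mod_orderOf b (r + 1), ← hb.eq_orderOf]
    exact congrArg (fun n => b ^ n) hQ
  have hweight : ∀ {i j l : ℕ}, coeff (expo i j l) F ≠ 0 → b ^ (i + (r + 1) * j) = c := by
    intro i j l h
    have h1 := congrArg (coeff (expo i j l)) hβ
    have h2 : (![C b * X 0, C (b ^ Q) * X 1, (X 2 : MvPolynomial (Fin 3) L)]) =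
        fun k => C ((![b, b ^ Q, 1] : Fin 3 → L) k) * X k := by
      funext k
      fin_cases k <;> simp
    rw [h2, coeff_aeval_C_mul_X, coeff_C_mul] at h1
    have h3 := mul_right_cancel₀ h h1
    rw [← h3, Fin.prod_univ_three, hbQ]
    simp [expo, pow_add, pow_mul]
  have hcong : ∀ {i j l i' j' l' : ℕ}, coeff (expo i j l) F ≠ 0 → coeff (expo i' j' l') F ≠ 0 →
      ((r : ℤ) + 1) * r + 1 ∣ ((i' : ℤ) + (r + 1) * j') - (i + (r + 1) * j) := by
    intro i j l i' j' l' h h'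
    have h1 : b ^ (i + (r + 1) * j) = b ^ (i' + (r + 1) * j') :=
      (hweight h).trans (hweight h').symm
    have hb0 : b ≠ 0 := hb.ne_zero (by omega)
    have h2 := (hb.zpow_eq_one_iff_dvd
      (((i' + (r + 1) * j' : ℕ) : ℤ) - ((i + (r + 1) * j : ℕ) : ℤ))).1 (by
        rw [zpow_sub₀ hb0, zpow_natCast, zpow_natCast, h1, div_self (pow_ne_zero _ hb0)])
    push_cast at h2
    exact h2
  -- As x₂ does not divide F, some monomial omits x₂. Its rotations also occur in F, and the
  -- equality of their weights determines it.
  obtain ⟨d, hd, hd1⟩ := exists_coeff_ne_zero_of_not_X_dvd hX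
  rw [eq_expo d, hd1] at hd
  generalize d 0 = i at hd
  generalize d 2 = l at hd
  have hrot := coeff_rotate hμ hd
  have hrot' := coeff_rotate hμ hrot
  have hs := hsum hd
  have hi : (i : ℤ) = 2 * r + 2 := by
    have h1 := hcong hrot hd
    have h2 := hcong hrot' hd
    push_cast at h1 h2
    refine eq_of_dvd_of_zero_coordinate (l := l) (by omega) (by omega) (by omega) (by omega) ?_ ?_
    · simpa using h1
    · simpa using h2
  refine exists_eq_conicForm fun e he => ?_
  obtain ⟨i', j', l', rfl⟩ : ∃ i' j' l', e = expo i' j' l' := ⟨_, _, _, eq_expo e⟩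
  rw [mem_support_iff] at he
  have h1 := hcong hd he
  have h2 := hsum he
  rw [hi, Nat.cast_zero, mul_zero, add_zero] at h1
  simp only [Set.mem_insert_iff, Set.mem_singleton_iff, expo_inj]
  have h3 := mem_of_dvd (r := r) (i := i') (j := j') (l := l') (by omega) (by omega) (by omega)
    (by omega) (by omega) h1
  exact_mod_cast h3

end Support

/-! ### Numerical consequences of the hypotheses and the conclusion -/

section Main

/-- With q = k + r, q² + q + 1 = k(k + 2r + 1) + r² + r + 1, so k divides N. For t < 5 this makes k
too small for the lower bound. -/
theorem exists_eq_add_two {q k t : ℕ} (hq : 2 ≤ q) (hdvd : k ∣ q ^ 2 + q + 1)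
    (hlt : (2 / 3 : ℚ) * (q + 2) < k) (hdeg : (t : ℤ) = q - k + 2) :
    ∃ r, t = r + 2 ∧ 3 ≤ r ∧ q = k + r ∧ k ∣ (r + 1) * r + 1 := by
  have hlt' : 2 * (q + 2) < 3 * k := by
    have : (2 : ℚ) * (q + 2) < 3 * k := by linarith
    exact_mod_cast this
  have hdvd' : (k : ℤ) ∣ ((t : ℤ) - 1) * (t - 2) + 1 := by
    obtain ⟨m, hm⟩ := hdvd
    have hm' : (q : ℤ) ^ 2 + q + 1 = k * m := by exact_mod_cast hm
    refine ⟨m - (k + 2 * (t - 2) + 1), ?_⟩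
    have hq' : (q : ℤ) = k + t - 2 := by omega
    rw [hq'] at hm'
    linear_combination hm'
  rcases (show t = 0 ∨ t = 1 ∨ 2 ≤ t by omega) with rfl | rfl | ht
  · have := Int.le_of_dvd (by norm_num) hdvd'
    norm_num at this
    omega
  · have := Int.le_of_dvd (by norm_num) hdvd'
    norm_num at this
    omega
  · obtain ⟨r, rfl⟩ := Nat.exists_eq_add_of_le' ht
    have hd : k ∣ (r + 1) * r + 1 := by
      have h : ((r + 2 : ℕ) : ℤ) - 1 = r + 1 ∧ ((r + 2 : ℕ) : ℤ) - 2 = r := by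
        constructor <;> push_cast <;> ring
      rw [h.1, h.2] at hdvd'
      exact_mod_cast hdvd'
    have hle := Nat.le_of_dvd (by omega) hd
    refine ⟨r, rfl, ?_, by omega, hd⟩
    by_contra! hr
    interval_cases r <;> omega

/-- Squaring turns the bound into 3k ≥ 2r² + 6r + 10. This gives N < 2k, so the cofactor of k in N
is 1; it fails with k = N for r = 3 and r = 4. -/
theorem eq_of_sqrt_le {k r : ℕ} (hr : 3 ≤ r) (hdvd : k ∣ (r + 1) * r + 1)
    (h : ((k + r : ℕ) : ℝ) - √(3 / 2 * ((k + r : ℕ) : ℝ) + 1 / 16) + 9 / 4 ≤ (k : ℝ)) :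
    k = (r + 1) * r + 1 ∧ 5 ≤ r := by
  have h1 : (r : ℝ) + 9 / 4 ≤ √(3 / 2 * ((k + r : ℕ) : ℝ) + 1 / 16) := by
    push_cast at h ⊢
    linarith
  have h2 := Real.le_sqrt' (by positivity) |>.1 h1
  have h3 : 2 * r ^ 2 + 6 * r + 10 ≤ 3 * k := by
    have : (2 : ℝ) * r ^ 2 + 6 * r + 10 ≤ 3 * k := by
      push_cast at h2
      nlinarith
    exact_mod_cast this
  obtain ⟨m, hm⟩ := hdvd
  have hm0 : m ≠ 0 := by
    rintro rfl
    omega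
  have hm1 : m = 1 := by
    by_contra hne
    have := Nat.mul_le_mul_left k (show 2 ≤ m by omega)
    nlinarith
  rw [hm1, mul_one] at hm
  refine ⟨hm.symm, ?_⟩
  by_contra! hr5
  interval_cases r <;> omega

variable {L : Type*} [Field L]

theorem X_zero_dvd_conicForm (r : ℕ) (B₀ B₁ B₂ : L) : X 0 ∣ conicForm r 0 0 0 B₀ B₁ B₂ := by
  have hd : ∀ {i j l : ℕ} (c : L), i ≠ 0 →
      (X 0 : MvPolynomial (Fin 3) L) ∣ monomial (expo i j l) c := fun c hi =>
    X_dvd_monomial.2 (Or.inr (by simpa [expo] using hi))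
  simp only [conicForm, map_zero, zero_add]
  exact dvd_add (dvd_add (hd _ (by omega)) (hd _ (by omega))) (hd _ (by omega))

namespace IrredPlaneCurve

/-- The function field of the pullback of a conic under `Φ`, seen from the vertex `A₃`. -/
theorem conicVertex {r : ℕ} (C : IrredPlaneCurve L (2 * (r + 2))) {A₀ A₁ A₂ B₀ B₁ B₂ : L}
    (h : C.eqn = conicForm r A₀ A₁ A₂ B₀ B₁ B₂) (hA₀ : A₀ ≠ 0) (hA₁ : A₁ ≠ 0) (hA₂ : A₂ ≠ 0) :
    ConicVertex (C.imageField (r + 2)) C.x C.y r A₀ A₁ A₂ B₀ B₁ B₂ where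
  x_ne := C.ratio_ne_zero (by omega) 0 2
  y_ne := C.ratio_ne_zero (by omega) 1 2
  gen := rfl
  top := C.adjoin_x_y (by omega)
  A₀_ne := hA₀
  A₁_ne := hA₁
  A₂_ne := hA₂
  conic := by
    have h1 := (C.dvd_conicForm_iff A₀ A₁ A₂ B₀ B₁ B₂).1 (by rw [h])
    simp only [quadric, map_add, map_mul, map_pow, aeval_X, aeval_C, Matrix.cons_val_zero,
      Matrix.cons_val_one] at h1
    rw [← mul_assoc] at h1
    exact h1
  indep _ _ _ h := C.linear_independent h

theorem ratio_succ {n : ℕ} (C : IrredPlaneCurve L n) (hn : 1 < n) (i : Fin 3) :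
    C.ratio (i + 1 + 1) (i + 1) = C.ratio (i + 2) i / C.ratio (i + 1) i := by
  have hi : i + 1 + 1 = i + 2 := by rw [add_assoc]; rfl
  rw [hi]
  refine Subtype.ext ?_
  change C.coord (i + 2) / C.coord (i + 1) =
    (C.coord (i + 2) / C.coord i) / (C.coord (i + 1) / C.coord i)
  rw [div_div_div_cancel_right₀ (C.coord_ne_zero hn i)]

theorem ratio_succ_inv {n : ℕ} (C : IrredPlaneCurve L n) (i : Fin 3) :
    C.ratio (i + 1 + 2) (i + 1) = (C.ratio (i + 1) i)⁻¹ := by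
  have hi : i + 1 + 2 = i := by rw [add_assoc]; exact add_zero i
  rw [hi]
  refine Subtype.ext ?_
  change C.coord i / C.coord (i + 1) = (C.coord (i + 1) / C.coord i)⁻¹
  rw [inv_div]

theorem conicVertex_ratio {r : ℕ} (C : IrredPlaneCurve L (2 * (r + 2))) {A₀ A₁ A₂ B₀ B₁ B₂ : L}
    (h : C.eqn = conicForm r A₀ A₁ A₂ B₀ B₁ B₂) (hA₀ : A₀ ≠ 0) (hA₁ : A₁ ≠ 0) (hA₂ : A₂ ≠ 0) :
    ConicVertex (C.imageField (r + 2)) (C.ratio (2 + 1) 2) (C.ratio (2 + 2) 2) r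
      A₀ A₁ A₂ B₀ B₁ B₂ := by
  have h1 : (2 + 1 : Fin 3) = 0 := rfl
  have h2 : (2 + 2 : Fin 3) = 1 := rfl
  rw [h1, h2]
  exact C.conicVertex h hA₀ hA₁ hA₂

end IrredPlaneCurve

end Main

theorem mainTheorem3 {F L : Type*} [Field F] [Finite F] [Field L] [Algebra F L] [IsAlgClosure F L]
    (p : ℕ) [Fact p.Prime] [CharP F p] (k t : ℕ) (ω : L) (C : IrredPlaneCurve L (2 * t))
    (hC : IrredPlaneCurve.IsCyclicCurve F k t ω C)
    (hk : (Nat.card F : ℝ) - √(3 / 2 * (Nat.card F : ℝ) + 1 / 16) + 9 / 4 ≤ (k : ℝ) ∨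
      C.ImageIsConicOrLine t)
    (hp : ¬ (k : ℤ) ^ 2 - k + 1 ≡ 0 [ZMOD p]) :
    C.ImageIsConicOrLine t ∧
    (Module.finrank (C.imageField t) C.FunctionField : ℤ) = (t : ℤ) ^ 2 - 3 * t + 3 ∧
    ∃ D : Place L C.FunctionField →₀ ℤ, IsDifferent (C.imageField t) D ∧
      (C.IsFirstType t → divisorOrder D = 6 * ((t : ℤ) ^ 2 - 3 * t + 2)) ∧
      (¬ C.IsFirstType t → divisorOrder D = 3 * ((t : ℤ) ^ 2 - 3 * t + 2)) := by
  have : IsAlgClosed L := IsAlgClosure.isAlgClosed F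
  have hq : 2 ≤ Nat.card F := Finite.one_lt_card
  obtain ⟨r, rfl, hr, hqk, hdvd⟩ := exists_eq_add_two hq hC.dvd hC.lt hC.degree
  have hN : (((r + 1) * r + 1 : ℕ) : L) ≠ 0 := by
    intro h0
    have : CharP L p := charP_of_injective_algebraMap (algebraMap F L).injective p
    have hq0 : ((Nat.card F : ℕ) : L) = 0 := by
      have := Fintype.ofFinite F
      rw [Nat.card_eq_fintype_card, ← map_natCast (algebraMap F L), FiniteField.cast_card_eq_zero,
        map_zero]
    rw [hqk] at hq0
    refine hp ((Int.modEq_zero_iff_dvd).2 ((CharP.intCast_eq_zero_iff L p _).1 ?_))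
    push_cast at h0 hq0 ⊢
    -- In L one has q = 0, so k = -r and k² - k + 1 = r² + r + 1 = N.
    linear_combination h0 + (k - r - 1 : L) * hq0
  obtain ⟨c, hc, hμ⟩ := hC.mu
  obtain ⟨A₀, A₁, A₂, B₀, B₁, B₂, hF⟩ :
      ∃ A₀ A₁ A₂ B₀ B₁ B₂ : L, C.eqn = conicForm r A₀ A₁ A₂ B₀ B₁ B₂ := by
    rcases hk with hk | hk
    · rw [hqk] at hk
      obtain ⟨hkN, hr5⟩ := eq_of_sqrt_le hr hdvd hk
      obtain ⟨c', -, hβ⟩ := hC.beta _ rfl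
      have hb : IsPrimitiveRoot ((ω ^ (Nat.card F - 1)) ^
          ((Nat.card F ^ 2 + Nat.card F + 1) / k)) ((r + 1) * r + 1) := by
        obtain ⟨n, hn⟩ : ∃ n, Nat.card F = n + 1 := ⟨Nat.card F - 1, by omega⟩
        have h1 : IsPrimitiveRoot (ω ^ (Nat.card F - 1))
            (Nat.card F ^ 2 + Nat.card F + 1) := by
          refine hC.primitive.pow ?_ ?_
          · rw [Nat.sub_pos_iff_lt]
            exact Nat.one_lt_pow (by norm_num) hq
          · rw [hn, Nat.add_sub_cancel]
            refine Nat.sub_eq_of_eq_add ?_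
            ring
        refine h1.pow (by omega) ?_
        rw [← hkN, Nat.div_mul_cancel hC.dvd]
      refine exists_eq_conicForm_of_invariant hr5 C.homogeneous hb ?_ hβ hμ (hC.no_line 1)
      -- Here q = N + r, so b^(q+1) = b^(r+1).
      rw [hqk, hkN]
      exact (Nat.modEq_iff_dvd' (by omega)).2 ⟨1, by omega⟩ |>.symm
    · exact C.exists_eqn_eq_conicForm_of_imageIsConicOrLine hk
  rw [hF, aeval_rotate_conicForm, C_mul_conicForm] at hμ
  obtain ⟨hA₂, hA₀, hA₁, hB₁, hB₂, hB₀⟩ := conicForm_inj hμ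
  -- By μ the three square coefficients vanish together, and then x₁ divides every remaining
  -- monomial.
  have hA₀0 : A₀ ≠ 0 := by
    rintro rfl
    have h1 : A₁ = 0 := (mul_eq_zero.1 hA₀.symm).resolve_left hc
    have h2 : A₂ = 0 := by rw [hA₂, mul_zero]
    refine hC.no_line 0 ?_
    rw [hF, h1, h2]
    exact X_zero_dvd_conicForm r B₀ B₁ B₂
  have hA₁0 : A₁ ≠ 0 := by
    rintro rfl
    exact hA₀0 (by rw [hA₀, mul_zero])
  have hA₂0 : A₂ ≠ 0 := by
    rw [hA₂]
    exact mul_ne_zero hc hA₀0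
  obtain ⟨hfin, D, hD, h6, h3, hfst, hsnd⟩ := exists_isDifferent_of_conicVertex
    (x := fun i => C.ratio (i + 1) i) (y := fun i => C.ratio (i + 2) i) hN (by omega)
    (C.conicVertex_ratio hF hA₀0 hA₁0 hA₂0) (C.ratio_succ (by omega)) C.ratio_succ_inv
    hA₂ hA₀ hA₁ hB₁ hB₂ hB₀
  -- Nonzero discriminant means two transversal points on each line, hence two branches with orders
  -- 1 and r + 1 = t - 1 at each vertex. A vanishing one makes x have order 2 over the line, which
  -- excludes linear branches of the required kind.
  have htype : C.IsFirstType (r + 2) ↔ B₀ ^ 2 - 4 * A₀ * A₁ ≠ 0 := by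
    constructor
    · intro hft hd
      obtain ⟨P, _, _, ⟨m, l, hm, hl, hml, hlt⟩, _⟩ := hft 2
      exact hsnd hd P m l hm hl hml (by rw [hlt]; push_cast; ring)
    · intro hd i
      obtain ⟨P₁, P₂, hne, hP⟩ := hfst hd i
      have hlin : ∀ P ∈ ({P₁, P₂} : Set (Place L C.FunctionField)),
          C.IsLinearBranchAtVertex (r + 2) i P := fun P hP' =>
        ⟨1, r + 1, (hP P hP').1, (hP P hP').2, by omega, by push_cast; ring⟩
      exact ⟨P₁, P₂, hne, hlin P₁ (by simp), hlin P₂ (by simp)⟩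
  refine ⟨C.imageIsConicOrLine_of_eqn_eq_conicForm hF hA₁0, ?_, D, hD, fun hft => ?_,
    fun hft => ?_⟩
  · rw [hfin]
    push_cast
    ring
  · rw [h6 (htype.1 hft)]
    push_cast
    ring
  · rw [h3 (not_not.1 fun hd => hft (htype.2 hd))]
    push_cast
    ring
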